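/- Let $L$ be a finite-dimensional Lie algebra over an arbitrary field. **$L$-algebras.** An $L$-algebra is a Lie algebra $A$ with a homomorphism $L\to\operatorname{Der}A$, written $x\mapsto(a\mapsto x.a)$; it is irreducible if it is irreducible as an $L$-module. Put $C_L(A)=\{x\in L: x.a=0\ \forall a\in A\}$ and $I_L(A)=\{x\in L:\exists a\in A\ \forall b\in A,\ x.b=[a,b]\}$. Two $L$-algebras $A,B$ are $L$-equivalent, $A\sim_L B$, if there is an isomorphism $A\rtimes L\to B\rtimes L$ of semi-direct sums that maps $A$ onto $B$ and induces the identity on $L$. **Chief factors.** A chief factor $A/B$ of $L$ is given by ideals $B\subsetneq A$ of $L$ with no ideal of $L$ strictly between them; it is an $L$-algebra in the natural way. It is Frattini if $A/B$ is contained in the Frattini ideal of $L/B$ (the largest ideal contained in all maximal subalgebras). A proper subalgebra $M$ supplements $A/B$ if $L=A+M$ and $B\subseteq A\cap M$. A subalgebra $M$ complements $A/B$ if $L=A+M$ and $A\cap M=B$. A chief factor is a $c$-factor if it is complemented by some subalgebra and a $c'$-factor otherwise; it is an $m$-factor if it is complemented by a maximal subalgebra and an $m'$-factor otherwise. For chief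 factors, $A/B\searrow C/D$ (equivalently $C/D\swarrow A/B$) means $A=B+C$ and $B\cap C=D$. An $m$-crossing $[A/B\searrow C/D]$ is a pair $A/B\searrow C/D$ with $A/B$ Frattini and $C/D$ supplemented by a maximal subalgebra. Chief factors $A/B$ and $C/D$ are $m$-related if one of the following holds: (1) $A/B\swarrow R/S\searrow C/D$ for some supplemented chief factor $R/S$; (2) there is an $m$-crossing $[U/V\searrow W/X]$ with $A/B\swarrow V/X$ and $W/X\searrow C/D$; (3) $A/B\searrow Y/Z\swarrow C/D$ for some Frattini chief factor $Y/Z$; (4) there is an $m$-crossing $[U/V\searrow W/X]$ with $A/B\searrow U/V$ and $U/W\swarrow C/D$. **$cc'$-type.** An irreducible $L$-algebra $A$ is of $cc'$-type if there are two chief series $0=X_0<\dots<X_n=L$ and $0=Y_0<\dots<Y_m=L$, a bijection $\pi:\{1,\dots,n\}\to\{1,\dots,m\}$ such that $X_j/X_{j-1}$ and $Y_{\pi(j)}/Y_{\pi(j)-1}$ are $m$-related for all $j$, and an index $i$ such that $A\sim_L X_i/X_{i-1}$, both $X_i/X_{i-1}$ and $Y_{\pi(i)}/Y_{\pi(i)-1}$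 are nonabelian $m'$-factors, one of the two is a $c$-factor, say $A^*/A_*$, and the other is a $c'$-factor, say $E^*/E$, and there are a nonabelian chief $c'$-factor $B^*/B$ with $B^*/B\searrow A^*/A_*$ and $B^*/B\searrow E^*/E$, and ideals $I=I_L(A^*/A_*)$, $C=C_L(A^*/A_*)$, $X$, $N$ of $L$ such that (i) $I/C\searrow B^*/B$ and $I/C$ is a $c'$-factor; (ii) $X\subseteq I$, $N=X\cap C$, $X/N\searrow A^*/A_*$, $I/C\searrow X/N$, and $X/N$ is a $c$-factor; (iii) there is a supplement $F$ of $I/C$ in $L$ such that $L/N$ is isomorphic to the natural semi-direct sum of $I/C$ by $F/C$; (iv) $L/C$ has a maximal subalgebra containing no nonzero ideal of $L/C$, it has a unique minimal ideal, this ideal is nonabelian, and the socle of $L/C$ is $I/C$. **Proposition.** The number $v$ of $L$-equivalence classes of irreducible $L$-algebras of $cc'$-type is finite, and the numbers of complemented chief factors in any two chief series of $L$ differ by at most $v$. -/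

import Mathlib

namespace ChiefFactors

universe v u

section Basic

variable (K : Type v) [Field K] (L : Type u) [LieRing L] [LieAlgebra K L]

/-- An `L`-algebra: a Lie algebra together with a homomorphism from `L` to its derivation
algebra. -/
structure LAlg where
  carrier : Type u
  [lieRing : LieRing carrier]
  [lieAlgebra : LieAlgebra K carrier]
  action : L →ₗ⁅K⁆ LieDerivation K carrier carrier

attribute [instance] LAlg.lieRing LAlg.lieAlgebra

end Basic

section LAlgebras

variable {K : Type v} [Field K] {L : Type u} [LieRing L] [LieAlgebra K L]

/-- The semi-direct sum `A ⋊ L`. -/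
abbrev LAlg.SemiSum (A : LAlg K L) : Type u :=
  LieAlgebra.SemiDirectSum A.carrier L A.action

/-- `L`-equivalence: an isomorphism `Φ : A ⋊ L → B ⋊ L` that restricts to an isomorphism
`φ : A → B` and induces the identity on `L`. -/
def LAlg.Equivalent (A B : LAlg K L) : Prop :=
  ∃ (Φ : A.SemiSum ≃ₗ⁅K⁆ B.SemiSum) (φ : A.carrier ≃ₗ⁅K⁆ B.carrier),
    (∀ a : A.carrier, Φ (LieAlgebra.SemiDirectSum.inl A.action a) =
      LieAlgebra.SemiDirectSum.inl B.action (φ a)) ∧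
    (∀ p : A.SemiSum, LieAlgebra.SemiDirectSum.projr B.action (Φ p) =
      LieAlgebra.SemiDirectSum.projr A.action p)

theorem LAlg.Equivalent.refl (A : LAlg K L) : A.Equivalent A :=
  ⟨LieEquiv.refl, LieEquiv.refl, fun _ => rfl, fun _ => rfl⟩

theorem LAlg.Equivalent.symm {A B : LAlg K L} (h : A.Equivalent B) : B.Equivalent A := by
  obtain ⟨Φ, φ, h₁, h₂⟩ := h
  refine ⟨Φ.symm, φ.symm, fun b => ?_, fun p => ?_⟩
  · have := h₁ (φ.symm b)
    rw [LieEquiv.apply_symm_apply] at this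
    rw [← this, LieEquiv.symm_apply_apply]
  · rw [← h₂ (Φ.symm p), LieEquiv.apply_symm_apply]

theorem LAlg.Equivalent.trans {A B C : LAlg K L} (h : A.Equivalent B) (h' : B.Equivalent C) :
    A.Equivalent C := by
  obtain ⟨Φ, φ, h₁, h₂⟩ := h
  obtain ⟨Ψ, ψ, h₃, h₄⟩ := h'
  refine ⟨Φ.trans Ψ, φ.trans ψ, fun a => ?_, fun p => ?_⟩
  · rw [LieEquiv.trans_apply, LieEquiv.trans_apply, h₁, h₃]
  · rw [LieEquiv.trans_apply, h₄, h₂]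

variable (K L) in
/-- `L`-equivalence as a setoid on `L`-algebras. -/
instance lAlgSetoid : Setoid (LAlg K L) where
  r := LAlg.Equivalent
  iseqv := ⟨LAlg.Equivalent.refl, LAlg.Equivalent.symm, LAlg.Equivalent.trans⟩

/-- `A` is irreducible as an `L`-module. -/
def LAlg.IsIrreducible (A : LAlg K L) : Prop :=
  Nontrivial A.carrier ∧ ∀ V : Submodule K A.carrier,
    (∀ (x : L), ∀ a ∈ V, A.action x a ∈ V) → V = ⊥ ∨ V = ⊤

/-- The centralizer `C_L(A)`. -/
def LAlg.centralizer (A : LAlg K L) : Set L :=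
  {x | ∀ a : A.carrier, A.action x a = 0}

/-- `I_L(A)`: the elements of `L` that act on `A` as inner derivations. -/
def LAlg.innerSet (A : LAlg K L) : Set L :=
  {x | ∃ a : A.carrier, ∀ b : A.carrier, A.action x b = ⁅a, b⁆}

/-- The natural projection `L → L / B` as a homomorphism of Lie algebras. -/
def quotMk (B : LieIdeal K L) : L →ₗ⁅K⁆ L ⧸ B where
  toFun x := LieSubmodule.Quotient.mk x
  map_add' _ _ := rfl
  map_smul' _ _ := rfl
  map_lie' {x y} := LieSubmodule.Quotient.mk_bracket (I := B) x y

/-- A Lie algebra acts on any of its ideals by derivations. -/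
def idealAction (J : LieIdeal K L) : L →ₗ⁅K⁆ LieDerivation K J J where
  toFun x :=
    { toFun := fun a => ⁅x, a⁆
      map_add' := fun a b => lie_add x a b
      map_smul' := fun c a => lie_smul c x a
      leibniz' := fun a b => by
        apply Subtype.ext
        change ⁅x, ⁅(a : L), (b : L)⁆⁆ = ⁅(a : L), ⁅x, (b : L)⁆⁆ - ⁅(b : L), ⁅x, (a : L)⁆⁆
        rw [leibniz_lie, ← lie_skew ⁅x, (a : L)⁆ (b : L)]
        abel }
  map_add' x y := by ext a; exact congrArg Subtype.val (add_lie x y a)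
  map_smul' c x := by ext a; exact congrArg Subtype.val (smul_lie c x a)
  map_lie' {x y} := by
    apply LieDerivation.ext
    intro a
    rw [LieDerivation.commutator_apply]
    exact lie_lie x y a

/-- The ideal `A / B` of `L / B` (for `B ≤ A`). -/
abbrev factor (A B : LieIdeal K L) : LieIdeal K (L ⧸ B) := A.map (quotMk B)

/-- The factor `A / B` of two ideals as an `L`-algebra. -/
def factorAlg (A B : LieIdeal K L) : LAlg K L where
  carrier := factor A B
  action := (idealAction (factor A B)).comp (quotMk B)

end LAlgebras

section Factors

variable {K : Type v} [Field K] {L : Type u} [LieRing L] [LieAlgebra K L]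

/-- `A / B` is a chief factor: `B < A` are ideals of `L` with no ideal strictly in between. -/
def IsChief (A B : LieIdeal K L) : Prop := B ⋖ A

/-- The factor `A / B` is not an abelian Lie algebra. -/
def IsNonabelian (A B : LieIdeal K L) : Prop := ¬ IsLieAbelian (factor A B)

variable (K L) in
/-- The Frattini ideal: the largest ideal contained in every maximal subalgebra. -/
def frattiniIdeal : LieIdeal K L :=
  sSup {J | ∀ M : LieSubalgebra K L, IsCoatom M → (J : Set L) ⊆ M}

/-- `A / B` is a Frattini chief factor. -/
def IsFrattini (A B : LieIdeal K L) : Prop :=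
  IsChief A B ∧ factor A B ≤ frattiniIdeal K (L ⧸ B)

/-- The proper subalgebra `M` supplements `A / B`: `L = A + M` and `B ⊆ A ∩ M`. -/
def IsSupplement (M : LieSubalgebra K L) (A B : LieIdeal K L) : Prop :=
  M ≠ ⊤ ∧ A.toSubmodule ⊔ M.toSubmodule = ⊤ ∧ B.toSubmodule ≤ A.toSubmodule ⊓ M.toSubmodule

/-- `M` complements `A / B`: `L = A + M` and `A ∩ M = B`. -/
def IsComplement (M : LieSubalgebra K L) (A B : LieIdeal K L) : Prop :=
  A.toSubmodule ⊔ M.toSubmodule = ⊤ ∧ A.toSubmodule ⊓ M.toSubmodule = B.toSubmodule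

/-- `A / B` is complemented in `L` (a `c`-factor, when it is a chief factor). -/
def IsC (A B : LieIdeal K L) : Prop := ∃ M : LieSubalgebra K L, IsComplement M A B

/-- `A / B` is complemented by a maximal subalgebra (an `m`-factor, when it is a chief factor). -/
def IsM (A B : LieIdeal K L) : Prop :=
  ∃ M : LieSubalgebra K L, IsCoatom M ∧ IsComplement M A B

/-- `A / B ↘ C / D` for chief factors. -/
def Down (A B C D : LieIdeal K L) : Prop :=
  IsChief A B ∧ IsChief C D ∧ A = B ⊔ C ∧ B ⊓ C = D

/-- The `m`-crossing `[A / B ↘ C / D]`. -/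
def MCrossing (A B C D : LieIdeal K L) : Prop :=
  Down A B C D ∧ IsFrattini A B ∧ ∃ M : LieSubalgebra K L, IsCoatom M ∧ IsSupplement M C D

/-- The chief factors `A / B` and `C / D` are `m`-related. -/
def MRelated (A B C D : LieIdeal K L) : Prop :=
  (∃ R S : LieIdeal K L, (∃ M : LieSubalgebra K L, IsSupplement M R S) ∧
    Down R S A B ∧ Down R S C D) ∨
  (∃ U V W X : LieIdeal K L, MCrossing U V W X ∧ Down V X A B ∧ Down W X C D) ∨
  (∃ Y Z : LieIdeal K L, IsFrattini Y Z ∧ Down A B Y Z ∧ Down C D Y Z) ∨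
  (∃ U V W X : LieIdeal K L, MCrossing U V W X ∧ Down A B U V ∧ Down C D U W)

variable (K L) in
/-- `L` has a core-free maximal subalgebra. -/
def IsPrimitive : Prop :=
  ∃ M : LieSubalgebra K L, IsCoatom M ∧ ∀ J : LieIdeal K L, (J : Set L) ⊆ M → J = ⊥

variable (K L) in
/-- `L` is primitive of type 2: its unique minimal ideal is nonabelian. -/
def IsPrimitiveType2 : Prop :=
  IsPrimitive K L ∧ ∃ J : LieIdeal K L, IsAtom J ∧ (∀ J' : LieIdeal K L, IsAtom J' → J' = J) ∧
    ¬ IsLieAbelian J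

variable (K L) in
/-- The socle: the sum of the minimal ideals. -/
def socle : LieIdeal K L := sSup {J | IsAtom J}

/-- The natural semi-direct sum of the ideal `I / C` of `L / C` by the subalgebra `F / C`
(for `C ⊆ F`), which acts on `I / C` by restriction of the adjoint action. -/
abbrev FactorSemiSum (I C : LieIdeal K L) (F : LieSubalgebra K L) : Type u :=
  LieAlgebra.SemiDirectSum (factor I C) (F.map (quotMk C))
    ((idealAction (factor I C)).comp (F.map (quotMk C)).incl)

/-- A nonabelian `c'`-factor `B' / B` lying above a nonabelian `c`-factor `A' / A`, together with
ideals `I`, `C`, `X`, `N` where `I = I_L(A' / A)` and `C = C_L(A' / A)`. -/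
structure CrossingData (B' B A' A I C X N : LieIdeal K L) : Prop where
  down : Down B' B A' A
  nonabelian_top : IsNonabelian B' B
  nonabelian_bot : IsNonabelian A' A
  not_c : ¬ IsC B' B
  isC : IsC A' A
  I_eq : (I : Set L) = (factorAlg A' A).innerSet
  C_eq : (C : Set L) = (factorAlg A' A).centralizer
  /-- `I / C ↘ B' / B` and `I / C` is a `c'`-factor. -/
  one : Down I C B' B ∧ ¬ IsC I C
  /-- `X ⊆ I`, `N = X ∩ C`, `X / N ↘ A' / A`, `I / C ↘ X / N`, and `X / N` is a `c`-factor. -/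
  two : X ≤ I ∧ N = X ⊓ C ∧ Down X N A' A ∧ Down I C X N ∧ IsC X N
  /-- `L / N` is the natural semi-direct sum of `I / C` by `F / C` for a supplement `F`. -/
  three : ∃ F : LieSubalgebra K L, IsSupplement F I C ∧
    Nonempty ((L ⧸ N) ≃ₗ⁅K⁆ FactorSemiSum I C F)
  /-- `L / C` is primitive of type 2 with socle `I / C`. -/
  four : IsPrimitiveType2 K (L ⧸ C) ∧ socle K (L ⧸ C) = factor I C

end Factors

section Series

variable (K : Type v) [Field K] (L : Type u) [LieRing L] [LieAlgebra K L]

/-- A chief series `0 = X₀ < X₁ < ⋯ < Xₙ = L`. -/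
structure ChiefSeries where
  length : ℕ
  ideal : Fin (length + 1) → LieIdeal K L
  bot : ideal 0 = ⊥
  top : ideal (Fin.last length) = ⊤
  chief : ∀ i : Fin length, IsChief (ideal i.succ) (ideal i.castSucc)

variable {K L}

/-- The number of complemented chief factors in a chief series. -/
noncomputable def ChiefSeries.numComplemented (X : ChiefSeries K L) : ℕ :=
  Set.ncard {i : Fin X.length | IsC (X.ideal i.succ) (X.ideal i.castSucc)}

/-- Two nonabelian chief factors `A' / A` (a `c`-factor) and `E' / E` (a `c'`-factor), neither
complemented by a maximal subalgebra, for which there are a chief factor `B' / B` lying above both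
and ideals `I`, `C`, `X`, `N` as in `CrossingData`. -/
def CCPair (A' A E' E : LieIdeal K L) : Prop :=
  ¬ IsM A' A ∧ ¬ IsM E' E ∧ IsNonabelian A' A ∧ IsNonabelian E' E ∧ IsC A' A ∧ ¬ IsC E' E ∧
    ∃ B' B I C X N : LieIdeal K L, Down B' B E' E ∧ CrossingData B' B A' A I C X N

/-- The irreducible `L`-algebra `A` is of `cc'`-type: there are two chief series, matched by a
bijection whose corresponding factors are `m`-related, and an index `i` at which one of the two
corresponding factors is a `c`-factor and the other a `c'`-factor as in `CCPair`, with `A`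
equivalent to the factor of the first series. -/
def LAlg.IsCCType (A : LAlg K L) : Prop :=
  A.IsIrreducible ∧ ∃ (X Y : ChiefSeries K L) (π : Fin X.length ≃ Fin Y.length),
    (∀ i, MRelated (X.ideal i.succ) (X.ideal i.castSucc)
      (Y.ideal (π i).succ) (Y.ideal (π i).castSucc)) ∧
    ∃ i, A.Equivalent (factorAlg (X.ideal i.succ) (X.ideal i.castSucc)) ∧
      (CCPair (X.ideal i.succ) (X.ideal i.castSucc)
          (Y.ideal (π i).succ) (Y.ideal (π i).castSucc) ∨
        CCPair (Y.ideal (π i).succ) (Y.ideal (π i).castSucc)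
          (X.ideal i.succ) (X.ideal i.castSucc))

variable (K L) in
/-- The set of `L`-equivalence classes of irreducible `L`-algebras of `cc'`-type. -/
def ccClasses : Set (Quotient (lAlgSetoid K L)) :=
  {c | ∃ A : LAlg K L, A.IsCCType ∧ Quotient.mk (lAlgSetoid K L) A = c}

end Series

end ChiefFactors

namespace ChiefFactors

universe v u

variable {K : Type v} [Field K] {L : Type u} [LieRing L] [LieAlgebra K L]

/-! Chief factors are counted class by class under $L$-equivalence. The total number of factors in a
class is the same for all chief series: opposite sides of a diamond of ideals are equivalent
(`Down.equivalent`), and a function additive on diamonds has the same sum over all maximal chains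
(`CoverSum.unique`).

In a nonabelian class, a chief series has at most one factor that is not complemented. A factor
lying below an equivalent one centralizes it, so the cocycle describing the equivalence has a kernel
that complements the lower factor (`isC_of_equivalent`). The complemented factors of such a class
therefore number $n$ or $n-1$ in every series, where $n$ is the size of the class, and two series
differ by at most 1 there.

It remains to see that a class whose complemented count depends on the series is nonabelian and of
$cc'$-type. Some diamond $U > V, W > D$ must break additivity. Complements pass downwards, so $W/D$
is complemented while $U/V$ is not, up to symmetry. If a maximal subalgebra complemented $W/D$, the
other two sides would compensate (`Down.of_isM`). Hence $W/D$ is not an $m$-factor, which forces it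
to be nonabelian, and one complement of $W/D$ yields all the ideals required by the definition
(`exists_crossingData`). Two series differing only in this diamond then exhibit the type
(`Down.factorClass_mem_ccClasses`).

Finiteness follows from the same invariance: every $cc'$-class occurs in any fixed chief series. -/

/-! ### Factors of ideals as Lie algebras. -/

theorem quotMk_surjective (B : LieIdeal K L) : Function.Surjective (quotMk B) :=
  Quot.mk_surjective

theorem quotMk_eq_zero {B : LieIdeal K L} {x : L} : quotMk B x = 0 ↔ x ∈ B :=
  LieSubmodule.Quotient.mk_eq_zero'

theorem quotMk_eq_iff {B : LieIdeal K L} {x y : L} :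
    quotMk B x = quotMk B y ↔ x - y ∈ B := by
  rw [← sub_eq_zero, ← map_sub, quotMk_eq_zero]

theorem mem_factor {A B : LieIdeal K L} {y : L ⧸ B} :
    y ∈ factor A B ↔ ∃ a ∈ A, quotMk B a = y := by
  constructor
  · intro h
    obtain ⟨a, ha⟩ := LieIdeal.mem_map_of_surjective (quotMk_surjective B) h
    exact ⟨a, a.2, ha⟩
  · rintro ⟨a, ha, rfl⟩
    exact LieIdeal.mem_map ha

/-- The projection of an ideal `A` of `L` onto the factor `A / B`. -/
def toFactor (A B : LieIdeal K L) : A →ₗ⁅K⁆ factor A B where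
  toFun a := ⟨quotMk B a, LieIdeal.mem_map a.2⟩
  map_add' _ _ := rfl
  map_smul' _ _ := rfl
  map_lie' {a b} := Subtype.ext (LieHom.map_lie (quotMk B) a b)

theorem coe_toFactor {A B : LieIdeal K L} (a : A) : (toFactor A B a : L ⧸ B) = quotMk B a := rfl

theorem toFactor_surjective (A B : LieIdeal K L) : Function.Surjective (toFactor A B) := by
  rintro ⟨y, hy⟩
  obtain ⟨a, ha, rfl⟩ := mem_factor.1 hy
  exact ⟨⟨a, ha⟩, rfl⟩

theorem toFactor_eq_zero {A B : LieIdeal K L} {a : A} : toFactor A B a = 0 ↔ (a : L) ∈ B := by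
  rw [← quotMk_eq_zero, ← coe_toFactor]
  exact Subtype.ext_iff

theorem quotMk_lie_toFactor {A B : LieIdeal K L} (x : L) (a : A) :
    ⁅quotMk B x, toFactor A B a⁆ = toFactor A B ⁅x, a⁆ :=
  Subtype.ext (LieHom.map_lie (quotMk B) x (a : L)).symm

theorem isNonabelian_iff {A B : LieIdeal K L} :
    IsNonabelian A B ↔ ∃ a ∈ A, ∃ b ∈ A, ⁅a, b⁆ ∉ B := by
  unfold IsNonabelian
  rw [not_iff_comm]
  push Not
  constructor
  · intro h
    refine ⟨fun y z => ?_⟩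
    obtain ⟨a, rfl⟩ := toFactor_surjective A B y
    obtain ⟨b, rfl⟩ := toFactor_surjective A B z
    rw [← LieHom.map_lie, toFactor_eq_zero]
    exact h a a.2 b b.2
  · intro h a ha b hb
    have := h.trivial (toFactor A B ⟨a, ha⟩) (toFactor A B ⟨b, hb⟩)
    rw [← LieHom.map_lie, toFactor_eq_zero] at this
    exact this

/-- Two surjective homomorphisms with the same kernel have isomorphic targets. -/
theorem exists_lieEquiv_of_surjective {P X Y : Type*} [LieRing P] [LieAlgebra K P] [LieRing X]
    [LieAlgebra K X] [LieRing Y] [LieAlgebra K Y] (p : P →ₗ⁅K⁆ X) (q : P →ₗ⁅K⁆ Y)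
    (hp : Function.Surjective p) (hq : Function.Surjective q) (h : ∀ x, p x = 0 ↔ q x = 0) :
    ∃ e : X ≃ₗ⁅K⁆ Y, ∀ x, e (p x) = q x := by
  have key : ∀ x y, p x = p y ↔ q x = q y := fun x y => by
    rw [← sub_eq_zero, ← map_sub, h, map_sub, sub_eq_zero]
  choose s hs using hp
  have hsp : ∀ x, q (s (p x)) = q x := fun x => (key _ _).1 (hs _)
  let f : X →ₗ⁅K⁆ Y :=
    { toFun := fun x => q (s x)
      map_add' := fun x y => by
        rw [← map_add, ← key, map_add, hs, hs, hs]
      map_smul' := fun c x => by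
        rw [RingHom.id_apply, ← map_smul, ← key, map_smul, hs, hs]
      map_lie' := fun {x y} => by
        rw [← LieHom.map_lie, ← key, LieHom.map_lie, hs, hs, hs] }
  have hf : Function.Bijective f := by
    constructor
    · intro x y hxy
      have : p (s x) = p (s y) := (key _ _).2 hxy
      rwa [hs, hs] at this
    · intro y
      obtain ⟨x, rfl⟩ := hq y
      exact ⟨p x, hsp x⟩
  exact ⟨LieEquiv.ofBijective f hf, hsp⟩

/-! ### $L$-equivalence as an isomorphism twisted by a cocycle. -/

open LieAlgebra in
/-- A twisted equivariant isomorphism gives an equivalence of `L`-algebras. -/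
theorem LAlg.Equivalent.of_lieEquiv {X Y : LAlg K L} (φ : X.carrier ≃ₗ⁅K⁆ Y.carrier)
    (β : L →ₗ[K] Y.carrier)
    (h₁ : ∀ x a, φ (X.action x a) = Y.action x (φ a) + ⁅β x, φ a⁆)
    (h₂ : ∀ x y, β ⁅x, y⁆ = Y.action x (β y) - Y.action y (β x) + ⁅β x, β y⁆) :
    X.Equivalent Y := by
  -- The map is $(a,x)\mapsto(\varphi a+\beta x,x)$; `h₁` and `h₂` are its compatibility with
  -- brackets of type $[L,A]$ and $[L,L]$.
  let f : X.SemiSum →ₗ⁅K⁆ Y.SemiSum :=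
    { toFun := fun p => ⟨φ p.left + β p.right, p.right⟩
      map_add' := fun p q => by
        simp only [SemiDirectSum.add_eq_mk, map_add]
        congr 1
        abel
      map_smul' := fun c p => by
        simp only [SemiDirectSum.smul_eq_mk, map_smul, smul_add, RingHom.id_apply]
      map_lie' := fun {p q} => by
        simp only [SemiDirectSum.lie_eq_mk, map_add, map_sub, LieEquiv.map_lie, h₁, h₂, lie_add,
          add_lie]
        congr 1
        rw [← lie_skew (β q.right) (φ p.left)]
        abel }
  have hf : Function.Bijective f := by
    constructor
    · rintro ⟨a, x⟩ ⟨b, y⟩ h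
      have hr : x = y := congrArg SemiDirectSum.right h
      subst hr
      have hl : φ a + β x = φ b + β x := congrArg SemiDirectSum.left h
      rw [φ.injective (add_right_cancel hl)]
    · rintro ⟨b, x⟩
      refine ⟨⟨φ.symm (b - β x), x⟩, ?_⟩
      change (⟨φ (φ.symm (b - β x)) + β x, x⟩ : Y.SemiSum) = ⟨b, x⟩
      rw [LieEquiv.apply_symm_apply, sub_add_cancel]
  refine ⟨LieEquiv.ofBijective f hf, φ, fun a => ?_, fun p => rfl⟩
  change (⟨φ a + β 0, 0⟩ : Y.SemiSum) = ⟨φ a, 0⟩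
  rw [map_zero, add_zero]

open LieAlgebra in
/-- An equivalence of `L`-algebras is given by a twisted equivariant isomorphism. -/
theorem LAlg.Equivalent.exists_lieEquiv {X Y : LAlg K L} (h : X.Equivalent Y) :
    ∃ (φ : X.carrier ≃ₗ⁅K⁆ Y.carrier) (β : L →ₗ[K] Y.carrier),
      (∀ x a, φ (X.action x a) = Y.action x (φ a) + ⁅β x, φ a⁆) ∧
      ∀ x y, β ⁅x, y⁆ = Y.action x (β y) - Y.action y (β x) + ⁅β x, β y⁆ := by
  obtain ⟨Φ, φ, hφ, hΦ⟩ := h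
  let β : L →ₗ[K] Y.carrier := SemiDirectSum.projl Y.action ∘ₗ
    (Φ : X.SemiSum →ₗ[K] Y.SemiSum) ∘ₗ (SemiDirectSum.inr X.action : L →ₗ[K] X.SemiSum)
  have hβ : ∀ x, Φ (SemiDirectSum.inr X.action x) = ⟨β x, x⟩ := fun x =>
    SemiDirectSum.ext rfl (hΦ (SemiDirectSum.inr X.action x))
  refine ⟨φ, β, fun x a => ?_, fun x y => ?_⟩
  · have := LieEquiv.map_lie Φ (SemiDirectSum.inr X.action x) (SemiDirectSum.inl X.action a)
    rw [hβ, hφ] at this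
    have e : ⁅SemiDirectSum.inr X.action x, SemiDirectSum.inl X.action a⁆ =
        SemiDirectSum.inl X.action (X.action x a) := by simp
    rw [e, hφ] at this
    have := congrArg SemiDirectSum.left this
    simp only [SemiDirectSum.inl_eq_mk, SemiDirectSum.lie_eq_mk, map_zero] at this
    rw [this, LieDerivation.coe_zero, Pi.zero_apply, sub_zero, add_comm]
  · have := LieEquiv.map_lie Φ (SemiDirectSum.inr X.action x) (SemiDirectSum.inr X.action y)
    rw [← LieHom.map_lie, hβ, hβ, hβ] at this
    have := congrArg SemiDirectSum.left this
    simp only [SemiDirectSum.lie_eq_mk] at this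
    rw [this]
    abel

theorem factorAlg_equivalent_iff {A B A' B' : LieIdeal K L} :
    (factorAlg A B).Equivalent (factorAlg A' B') ↔
      ∃ (φ : factor A B ≃ₗ⁅K⁆ factor A' B') (β : L →ₗ[K] factor A' B'),
        (∀ (x : L) (y : factor A B), φ ⁅quotMk B x, y⁆ = ⁅quotMk B' x, φ y⁆ + ⁅β x, φ y⁆) ∧
        ∀ x y : L, β ⁅x, y⁆ = ⁅quotMk B' x, β y⁆ - ⁅quotMk B' y, β x⁆ + ⁅β x, β y⁆ :=
  ⟨fun h => h.exists_lieEquiv, fun ⟨φ, β, h₁, h₂⟩ =>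
    LAlg.Equivalent.of_lieEquiv (X := factorAlg A B) (Y := factorAlg _ _) φ β h₁ h₂⟩

/-! ### Subalgebras, complements and centralizers. -/

/-- The sum of an ideal and a subalgebra is a subalgebra. -/
def supSubalgebra (J : LieIdeal K L) (M : LieSubalgebra K L) : LieSubalgebra K L where
  __ := J.toSubmodule ⊔ M.toSubmodule
  lie_mem' := by
    intro x y hx hy
    obtain ⟨j, hj, m, hm, rfl⟩ := Submodule.mem_sup.1 hx
    obtain ⟨k, hk, n, hn, rfl⟩ := Submodule.mem_sup.1 hy
    refine Submodule.mem_sup.2 ⟨⁅j, k⁆ + ⁅j, n⁆ + ⁅m, k⁆, ?_, ⁅m, n⁆, M.lie_mem hm hn, ?_⟩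
    · exact J.add_mem (J.add_mem (lie_mem_left K L J _ _ hj) (lie_mem_left K L J _ _ hj))
        (lie_mem_right K L J _ _ hk)
    · simp only [lie_add, add_lie]
      abel

theorem mem_supSubalgebra {J : LieIdeal K L} {M : LieSubalgebra K L} {x : L} :
    x ∈ supSubalgebra J M ↔ ∃ j ∈ J, ∃ m ∈ M, j + m = x :=
  Submodule.mem_sup

theorem left_mem_supSubalgebra {J : LieIdeal K L} {M : LieSubalgebra K L} {x : L} (h : x ∈ J) :
    x ∈ supSubalgebra J M :=
  mem_supSubalgebra.2 ⟨x, h, 0, M.zero_mem, add_zero x⟩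

theorem le_supSubalgebra {J : LieIdeal K L} {M : LieSubalgebra K L} : M ≤ supSubalgebra J M :=
  fun x h => mem_supSubalgebra.2 ⟨0, J.zero_mem, x, h, zero_add x⟩

theorem sup_eq_top_iff {A : LieIdeal K L} {M : LieSubalgebra K L} :
    A.toSubmodule ⊔ M.toSubmodule = ⊤ ↔ ∀ x, ∃ a ∈ A, ∃ m ∈ M, a + m = x := by
  rw [Submodule.eq_top_iff']
  exact forall_congr' fun x => Submodule.mem_sup

theorem isComplement_iff {M : LieSubalgebra K L} {A B : LieIdeal K L} :
    IsComplement M A B ↔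
      (∀ x, ∃ a ∈ A, ∃ m ∈ M, a + m = x) ∧ ∀ x, (x ∈ A ∧ x ∈ M) ↔ x ∈ B := by
  rw [IsComplement, sup_eq_top_iff, SetLike.ext_iff]
  rfl

theorem isSupplement_iff {M : LieSubalgebra K L} {A B : LieIdeal K L} (h : B ≤ A) :
    IsSupplement M A B ↔
      M ≠ ⊤ ∧ (∀ x, ∃ a ∈ A, ∃ m ∈ M, a + m = x) ∧ ∀ x ∈ B, x ∈ M := by
  rw [IsSupplement, sup_eq_top_iff]
  refine and_congr_right fun _ => and_congr_right fun _ => ?_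
  exact ⟨fun hB x hx => (hB hx).2, fun hB x hx => ⟨h hx, hB x hx⟩⟩

theorem exists_add_of_isCoatom {M : LieSubalgebra K L} (hM : IsCoatom M) {J : LieIdeal K L}
    (hJ : ∃ x ∈ J, x ∉ M) (x : L) : ∃ a ∈ J, ∃ m ∈ M, a + m = x := by
  have : supSubalgebra J M = ⊤ := by
    refine hM.2 _ (lt_of_le_of_ne le_supSubalgebra fun h => ?_)
    obtain ⟨y, hy, hyM⟩ := hJ
    exact hyM (h ▸ left_mem_supSubalgebra hy)
  exact mem_supSubalgebra.1 (this ▸ LieSubalgebra.mem_top x)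

/-- If `L = A + M` and `A` carries `J ∩ M` into `M`, then `J ∩ M` is an ideal. -/
theorem exists_ideal_inf {M : LieSubalgebra K L} {A J : LieIdeal K L}
    (h : ∀ x, ∃ a ∈ A, ∃ m ∈ M, a + m = x) (hA : ∀ a ∈ A, ∀ j ∈ J, j ∈ M → ⁅a, j⁆ ∈ M) :
    ∃ N : LieIdeal K L, ∀ x, x ∈ N ↔ x ∈ J ∧ x ∈ M := by
  refine ⟨{ J.toSubmodule ⊓ M.toSubmodule with lie_mem := ?_ }, fun x => Iff.rfl⟩
  rintro x y ⟨hyJ, hyM⟩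
  refine ⟨lie_mem_right K L J _ _ hyJ, ?_⟩
  obtain ⟨a, ha, m, hm, rfl⟩ := h x
  rw [add_lie]
  exact M.add_mem (hA a ha y hyJ hyM) (M.lie_mem hm hyM)

theorem IsChief.eq_or_eq {A B J : LieIdeal K L} (h : IsChief A B) (h₁ : B ≤ J) (h₂ : J ≤ A) :
    J = B ∨ J = A :=
  CovBy.eq_or_eq h h₁ h₂

/-- The centralizer in `L` of the factor `A / B`. -/
def centralizerIdeal (A B : LieIdeal K L) : LieIdeal K L where
  carrier := {x | ∀ a ∈ A, ⁅x, a⁆ ∈ B}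
  add_mem' {x y} hx hy a ha := by
    rw [add_lie]
    exact B.add_mem (hx a ha) (hy a ha)
  zero_mem' a _ := by
    rw [zero_lie]
    exact B.zero_mem
  smul_mem' c x hx a ha := by
    rw [smul_lie]
    exact B.smul_mem c (hx a ha)
  lie_mem {x y} hy a ha := by
    rw [lie_lie]
    exact B.sub_mem (lie_mem_right K L B _ _ (hy a ha)) (hy _ (lie_mem_right K L A _ _ ha))

theorem le_centralizerIdeal (A B : LieIdeal K L) : B ≤ centralizerIdeal A B :=
  fun _ hx _ _ => lie_mem_left K L B _ _ hx

/-- A nonabelian chief factor has trivial center. -/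
theorem IsChief.centralizerIdeal_inf {A B : LieIdeal K L} (h : IsChief A B)
    (hn : IsNonabelian A B) : centralizerIdeal A B ⊓ A = B := by
  refine (h.eq_or_eq (le_inf (le_centralizerIdeal A B) h.le) inf_le_right).resolve_right ?_
  intro he
  obtain ⟨a, ha, b, hb, hab⟩ := isNonabelian_iff.1 hn
  exact hab ((inf_eq_right.1 he) ha b hb)

/-! ### Moving equivalences and complements across a diamond. -/

theorem Down.lie_mem {A B C D : LieIdeal K L} (h : Down A B C D) {x y : L} (hx : x ∈ B)
    (hy : y ∈ C) : ⁅x, y⁆ ∈ D := by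
  rw [← h.2.2.2]
  exact ⟨lie_mem_left K L B _ _ hx, lie_mem_right K L C _ _ hy⟩

theorem Down.mem_iff {A B C D : LieIdeal K L} (h : Down A B C D) {x : L} :
    x ∈ D ↔ x ∈ B ∧ x ∈ C := by
  rw [← h.2.2.2, LieSubmodule.mem_inf]

theorem Down.exists_add {A B C D : LieIdeal K L} (h : Down A B C D) {x : L} (hx : x ∈ A) :
    ∃ b ∈ B, ∃ c ∈ C, b + c = x := by
  rwa [h.2.2.1, LieSubmodule.mem_sup] at hx

theorem Down.le_left {A B C D : LieIdeal K L} (h : Down A B C D) : C ≤ A :=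
  h.2.2.1 ▸ le_sup_right

theorem IsChief.down_self {A B : LieIdeal K L} (h : IsChief A B) : Down A B A B :=
  ⟨h, h, (sup_eq_right.2 h.le).symm, inf_eq_left.2 h.le⟩

/-- Second isomorphism theorem: the inclusion of $C$ in $A$ induces the isomorphism, and no twist is
needed. -/
theorem Down.equivalent {A B C D : LieIdeal K L} (h : Down A B C D) :
    (factorAlg C D).Equivalent (factorAlg A B) := by
  let i : C →ₗ⁅K⁆ A := LieIdeal.inclusion h.le_left
  obtain ⟨φ, hφ⟩ := exists_lieEquiv_of_surjective (toFactor C D) ((toFactor A B).comp i)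
    (toFactor_surjective C D) (by
      intro y
      obtain ⟨a, rfl⟩ := toFactor_surjective A B y
      obtain ⟨b, hb, c, hc, hbc⟩ := h.exists_add a.2
      refine ⟨⟨c, hc⟩, ?_⟩
      rw [LieHom.comp_apply, ← sub_eq_zero, ← map_sub, toFactor_eq_zero]
      have : ((i ⟨c, hc⟩ - a : A) : L) = -b := by
        change c - (a : L) = -b
        rw [← hbc]
        abel
      rw [this]
      exact B.neg_mem hb)
    (fun c => by
      rw [LieHom.comp_apply, toFactor_eq_zero, toFactor_eq_zero, h.mem_iff]
      exact ⟨fun hc => hc.1, fun hc => ⟨hc, c.2⟩⟩)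
  refine factorAlg_equivalent_iff.2 ⟨φ, 0, fun x y => ?_, fun x y => ?_⟩
  · obtain ⟨c, rfl⟩ := toFactor_surjective C D y
    rw [quotMk_lie_toFactor, hφ, hφ, LinearMap.zero_apply, zero_lie, add_zero,
      LieHom.comp_apply, LieHom.comp_apply, quotMk_lie_toFactor]
    rfl
  · simp

theorem IsComplement.of_down {A B C D : LieIdeal K L} (h : Down A B C D) {M : LieSubalgebra K L}
    (hM : IsComplement M A B) : IsComplement M C D := by
  obtain ⟨h₁, h₂⟩ := isComplement_iff.1 hM
  refine isComplement_iff.2 ⟨fun x => ?_, fun x => ?_⟩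
  · obtain ⟨a, ha, m, hm, rfl⟩ := h₁ x
    obtain ⟨b, hb, c, hc, rfl⟩ := h.exists_add ha
    exact ⟨c, hc, b + m, M.add_mem ((h₂ b).2 hb).2 hm, by abel⟩
  · rw [h.mem_iff]
    exact ⟨fun hx => ⟨(h₂ x).1 ⟨h.le_left hx.1, hx.2⟩, hx.1⟩, fun hx => ⟨hx.2, ((h₂ x).2 hx.1).2⟩⟩

theorem Down.isC {A B C D : LieIdeal K L} (h : Down A B C D) (hc : IsC A B) : IsC C D :=
  let ⟨M, hM⟩ := hc
  ⟨M, hM.of_down h⟩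

/-- If `L = A + M` and `A ∩ M ⊆ Q`, there is a linear map that is the projection to `J / Q` on
`A ⊆ J` and vanishes on `M`. -/
theorem exists_projection {M : LieSubalgebra K L} {A J Q : LieIdeal K L}
    (h : ∀ x, ∃ a ∈ A, ∃ m ∈ M, a + m = x) (hJ : A ≤ J) (hQ : ∀ x ∈ A, x ∈ M → x ∈ Q) :
    ∃ p : L →ₗ[K] factor J Q, (∀ a (ha : a ∈ A), p a = toFactor J Q ⟨a, hJ ha⟩) ∧
      ∀ m ∈ M, p m = 0 := by
  choose f hf m hm hfm using h
  let g : L → factor J Q := fun x => toFactor J Q ⟨f x, hJ (hf x)⟩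
  have key : ∀ x a (ha : a ∈ A), x - a ∈ M → g x = toFactor J Q ⟨a, hJ ha⟩ := by
    intro x a ha hx
    rw [← sub_eq_zero, ← map_sub, toFactor_eq_zero]
    refine hQ _ (A.sub_mem (hf x) ha) ?_
    have : f x - a = (x - a) - m x := by
      rw [eq_sub_of_add_eq (hfm x)]
      abel
    change f x - a ∈ M
    rw [this]
    exact M.sub_mem hx (hm x)
  have hsub : ∀ x, x - f x ∈ M := fun x => by
    have : x - f x = m x := sub_eq_of_eq_add' (hfm x).symm
    rw [this]
    exact hm x
  refine ⟨{ toFun := g, map_add' := fun x y => ?_, map_smul' := fun c x => ?_ }, ?_, ?_⟩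
  · rw [key (x + y) (f x + f y) (A.add_mem (hf x) (hf y)) (by
      rw [add_sub_add_comm]
      exact M.add_mem (hsub x) (hsub y))]
    rfl
  · rw [key (c • x) (c • f x) (A.smul_mem c (hf x)) (by
      rw [← smul_sub]
      exact M.smul_mem c (hsub x))]
    rfl
  · exact fun a ha => key a a ha (by simp)
  · intro x hx
    refine (key x 0 A.zero_mem (by simpa using hx)).trans ?_
    rw [toFactor_eq_zero]
    exact Q.zero_mem

theorem IsComplement.of_le {U V W D : LieIdeal K L} (h : Down U V W D) {M : LieSubalgebra K L}
    (hM : IsComplement M W D) (hV : ∀ x ∈ V, x ∈ M) : IsComplement M U V := by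
  obtain ⟨h₁, h₂⟩ := isComplement_iff.1 hM
  refine isComplement_iff.2 ⟨fun x => ?_, fun x => ⟨fun hx => ?_, fun hx => ?_⟩⟩
  · obtain ⟨w, hw, m, hm, rfl⟩ := h₁ x
    exact ⟨w, h.le_left hw, m, hm, rfl⟩
  · obtain ⟨v, hv, w, hw, rfl⟩ := h.exists_add hx.1
    refine V.add_mem hv (h.mem_iff.1 ((h₂ w).1 ⟨hw, ?_⟩)).1
    simpa using M.sub_mem hx.2 (hV v hv)
  · exact ⟨h.1.le hx, hV x hx⟩

/-- $V\cap M$ is an ideal, because $L=W+M$ and $[W,V]\subseteq D\subseteq M$; as $V\not\subseteq M$,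
it can only be $D$. Together with `IsComplement.of_le` this settles both positions of $V$ relative
to a maximal complement of $W/D$. -/
theorem IsComplement.of_not_le {U V W D : LieIdeal K L} (h : Down U V W D) (hV : IsChief V D)
    {M : LieSubalgebra K L} (hc : IsCoatom M) (hM : IsComplement M W D) (hVM : ∃ x ∈ V, x ∉ M) :
    IsComplement M V D := by
  obtain ⟨h₁, h₂⟩ := isComplement_iff.1 hM
  obtain ⟨N, hN⟩ := exists_ideal_inf (J := V) h₁ (fun w hw v hv _ => by
    rw [← lie_skew]
    exact M.neg_mem ((h₂ _).2 (h.lie_mem hv hw)).2)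
  have hND : N = D := by
    refine (hV.eq_or_eq (fun x hx => ?_) (fun x hx => ((hN x).1 hx).1)).resolve_right ?_
    · exact (hN x).2 ⟨hV.le hx, ((h₂ x).2 hx).2⟩
    · rintro rfl
      obtain ⟨x, hx, hxM⟩ := hVM
      exact hxM ((hN x).1 hx).2
  refine isComplement_iff.2 ⟨exists_add_of_isCoatom hc hVM, fun x => ?_⟩
  rw [← hN, hND]

/-- A common complement of `V / D` and `W / D` carries complements of `U / W` to complements of
`U / V`. -/
theorem isC_of_common_complement {U V W D : LieIdeal K L} (h : Down U V W D)
    {M : LieSubalgebra K L} (hW : IsComplement M W D) (hV : IsComplement M V D)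
    (hc : IsC U W) : IsC U V := by
  obtain ⟨T, hT⟩ := hc
  obtain ⟨h₁, h₂⟩ := isComplement_iff.1 hW
  obtain ⟨-, h₃⟩ := isComplement_iff.1 hV
  obtain ⟨h₄, h₅⟩ := isComplement_iff.1 hT
  -- The complement is $V+(T\cap M)$. Since $W\subseteq T$, writing $t\in T$ as $w+m$ keeps $m$ in
  -- $T$; and $U\cap T\cap M=W\cap M=D$.
  refine ⟨supSubalgebra V (T ⊓ M), isComplement_iff.2 ⟨fun x => ?_, fun x => ⟨?_, fun hx => ?_⟩⟩⟩
  · obtain ⟨u, hu, t, ht, rfl⟩ := h₄ x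
    obtain ⟨w, hw, m, hm, rfl⟩ := h₁ t
    refine ⟨u + w, U.add_mem hu (h.le_left hw), m,
      le_supSubalgebra ((LieSubalgebra.mem_inf _ _ _).2 ⟨?_, hm⟩), by abel⟩
    simpa using T.sub_mem ht ((h₅ w).2 hw).2
  · rintro ⟨hxU, hx⟩
    obtain ⟨v, hv, m, hm, rfl⟩ := mem_supSubalgebra.1 hx
    obtain ⟨hmT, hmM⟩ := (LieSubalgebra.mem_inf _ _ _).1 hm
    have hmU : m ∈ U := by simpa using U.sub_mem hxU (h.1.le hv)
    have hmD : m ∈ D := (h₂ m).1 ⟨(h₅ m).1 ⟨hmU, hmT⟩, hmM⟩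
    exact V.add_mem hv ((h₃ m).2 hmD).1
  · exact ⟨h.1.le hx, left_mem_supSubalgebra hx⟩

/-- Two factors `W / D` and `V / D` with `V ∩ W = D` and a common complement are equivalent. -/
theorem equivalent_of_common_complement {U V W D : LieIdeal K L} (h : Down U V W D)
    {M : LieSubalgebra K L} (hW : IsComplement M W D) (hV : IsComplement M V D) :
    (factorAlg W D).Equivalent (factorAlg V D) := by
  obtain ⟨h₁, h₂⟩ := isComplement_iff.1 hW
  obtain ⟨h₃, h₄⟩ := isComplement_iff.1 hV
  obtain ⟨p, hpV, hpM⟩ := exists_projection h₃ le_rfl (fun x hx hxM => (h₄ x).1 ⟨hx, hxM⟩)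
  have hpD : ∀ d ∈ D, p d = 0 := fun d hd => hpM d ((h₂ d).2 hd).2
  have key : ∀ w ∈ W, ∃ v : V, w + v ∈ M ∧ p w = -toFactor V D v := by
    intro w _
    obtain ⟨v, hv, m, hm, rfl⟩ := h₃ w
    refine ⟨-⟨v, hv⟩, ?_, ?_⟩
    · change v + m + -v ∈ M
      simpa using hm
    · rw [map_add, hpV v hv, hpM m hm, map_neg, neg_neg, add_zero]
  -- The map sends $w$ to the class of a $v$ with $w+v\in M$. It respects brackets because $V$ and
  -- $W$ commute modulo $D$, so $[w+v,w'+v']\in M$ reduces to $[w,w']+[v,v']$.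
  let q : W →ₗ⁅K⁆ factor V D :=
    { toFun := fun w => -p w
      map_add' := fun w w' => by
        rw [LieSubmodule.coe_add, map_add, neg_add]
      map_smul' := fun c w => by
        rw [LieSubmodule.coe_smul, map_smul, smul_neg, RingHom.id_apply]
      map_lie' := fun {w w'} => by
        obtain ⟨v, hv, hpv⟩ := key w w.2
        obtain ⟨v', hv', hpv'⟩ := key w' w'.2
        have e := hpM _ (M.lie_mem hv hv')
        rw [lie_add, add_lie, add_lie, map_add, map_add, map_add, hpD _ (h.lie_mem v.2 w'.2),
          ← lie_skew (w : L) (v' : L), map_neg, hpD _ (h.lie_mem v'.2 w.2), neg_zero, add_zero,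
          zero_add, hpV _ (lie_mem_left K L V _ _ v.2)] at e
        change -p ⁅(w : L), (w' : L)⁆ = ⁅-p w, -p w'⁆
        rw [hpv, hpv', neg_neg, neg_neg, ← LieHom.map_lie, eq_neg_of_add_eq_zero_left e, neg_neg]
        rfl }
  have hq : ∀ w : W, q w = -p w := fun _ => rfl
  obtain ⟨φ, hφ⟩ := exists_lieEquiv_of_surjective (toFactor W D) q (toFactor_surjective W D) (by
      intro y
      obtain ⟨v, rfl⟩ := toFactor_surjective V D y
      obtain ⟨w, hw, m, hm, hwm⟩ := h₁ v
      refine ⟨-⟨w, hw⟩, ?_⟩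
      have e : p w = p v - p m := by rw [← hwm, map_add, add_sub_cancel_right]
      rw [map_neg, hq, neg_neg]
      change p w = _
      rw [e, hpM m hm, sub_zero, hpV v v.2])
    (fun w => by
      rw [toFactor_eq_zero, hq, neg_eq_zero]
      refine ⟨hpD w, fun hw => ?_⟩
      obtain ⟨v, hv, hpv⟩ := key w w.2
      rw [hw, zero_eq_neg, toFactor_eq_zero] at hpv
      refine (h₂ w).1 ⟨w.2, ?_⟩
      simpa using M.sub_mem hv ((h₂ _).2 hpv).2)
  have hact : ∀ (x : L) (v : V), ⁅quotMk D x, toFactor V D v⁆ =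
      p ⁅x, (v : L)⁆ := fun x v => by
    rw [quotMk_lie_toFactor, hpV _ (lie_mem_right K L V _ _ v.2)]
    rfl
  have hlie : ∀ v w : V, ⁅toFactor V D v, toFactor V D w⁆ = p ⁅(v : L), (w : L)⁆ := fun v w => by
    rw [← LieHom.map_lie, hpV _ (lie_mem_right K L V _ _ w.2)]
    rfl
  -- `φ` commutes with the action of $M$, so the twist may vanish there. On $V$, which kills $W/D$,
  -- it must cancel the inner action of $V$ on $V/D$; hence the sign.
  refine factorAlg_equivalent_iff.2 ⟨φ, -p, fun x y => ?_, fun x y => ?_⟩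
  · obtain ⟨w, rfl⟩ := toFactor_surjective W D y
    obtain ⟨v, hv, hpv⟩ := key w w.2
    obtain ⟨v₀, hv₀, m, hm, rfl⟩ := h₃ x
    have e := hpM _ (M.lie_mem hm hv)
    rw [lie_add, map_add] at e
    rw [quotMk_lie_toFactor, hφ, hφ, hq, hq, hpv, neg_neg, hact, LinearMap.neg_apply,
      map_add, hpM m hm, hpV v₀ hv₀, add_zero, neg_lie, hlie]
    change -p ⁅v₀ + m, (w : L)⁆ = p ⁅v₀ + m, (v : L)⁆ + -p ⁅v₀, (v : L)⁆
    rw [add_lie, add_lie, map_add, map_add, hpD _ (h.lie_mem hv₀ w.2),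
      eq_neg_of_add_eq_zero_left e]
    abel
  · obtain ⟨v₀, hv₀, m, hm, rfl⟩ := h₃ x
    obtain ⟨v₁, hv₁, n, hn, rfl⟩ := h₃ y
    have e₀ : p (v₀ + m) = toFactor V D ⟨v₀, hv₀⟩ := by
      rw [map_add, hpM m hm, hpV v₀ hv₀, add_zero]
    have e₁ : p (v₁ + n) = toFactor V D ⟨v₁, hv₁⟩ := by
      rw [map_add, hpM n hn, hpV v₁ hv₁, add_zero]
    rw [LinearMap.neg_apply, LinearMap.neg_apply, LinearMap.neg_apply, e₀, e₁, lie_neg, lie_neg,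
      hact, hact, neg_lie, lie_neg, neg_neg, hlie]
    simp only [add_lie, lie_add, map_add, hpM _ (M.lie_mem hm hn)]
    rw [← lie_skew v₁ v₀, ← lie_skew n v₀, map_neg, map_neg]
    abel

/-- If a nonabelian chief factor `A / B` is equivalent to a factor centralized by `A`, then it is
complemented. -/
theorem isC_of_equivalent {A B A' B' : LieIdeal K L} (h : IsChief A B) (hn : IsNonabelian A B)
    (he : (factorAlg A B).Equivalent (factorAlg A' B')) (hA : A ≤ centralizerIdeal A' B') :
    IsC A B := by
  obtain ⟨φ, β, h₁, h₂⟩ := factorAlg_equivalent_iff.1 he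
  -- $A$ acts as zero on $A'/B'$, so `h₁` makes $\beta a$ and $\varphi(a+B)$ have the same adjoint
  -- action; a nonabelian chief factor has zero centre, so they are equal.
  have hβ : ∀ a : A, β a = φ (toFactor A B a) := by
    intro a
    obtain ⟨c, hc⟩ := toFactor_surjective A B (φ.symm (β a - φ (toFactor A B a)))
    have hc' : φ (toFactor A B c) = β a - φ (toFactor A B a) := by
      rw [hc, LieEquiv.apply_symm_apply]
    have hcB : (c : L) ∈ B := by
      rw [← h.centralizerIdeal_inf hn]
      refine ⟨fun b hb => ?_, c.2⟩
      have e := h₁ a (toFactor A B ⟨b, hb⟩)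
      have e₀ : ⁅quotMk B' (a : L), φ (toFactor A B ⟨b, hb⟩)⁆ = 0 := by
        obtain ⟨d, hd⟩ := toFactor_surjective A' B' (φ (toFactor A B ⟨b, hb⟩))
        rw [← hd, quotMk_lie_toFactor, toFactor_eq_zero]
        exact hA a.2 d d.2
      have e₁ : ⁅quotMk B (a : L), toFactor A B ⟨b, hb⟩⁆ =
          ⁅toFactor A B a, toFactor A B ⟨b, hb⟩⁆ := rfl
      rw [e₀, zero_add, e₁, LieEquiv.map_lie] at e
      have e₂ : φ (toFactor A B ⁅c, ⟨b, hb⟩⁆) = 0 := by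
        rw [LieHom.map_lie, LieEquiv.map_lie, hc', sub_lie, e, sub_self]
      have e₃ := φ.injective (e₂.trans (map_zero φ).symm)
      exact toFactor_eq_zero.1 e₃
    rw [toFactor_eq_zero.2 hcB, map_zero] at hc'
    exact (sub_eq_zero.1 hc'.symm)
  -- The kernel of a cocycle is a subalgebra. As $\beta$ restricts on $A$ to the projection onto
  -- $A/B$ followed by an isomorphism, this kernel is a complement.
  let M : LieSubalgebra K L :=
    { LinearMap.ker β with
      lie_mem' := by
        intro x y hx hy
        have hx : β x = 0 := hx
        have hy : β y = 0 := hy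
        change β ⁅x, y⁆ = 0
        rw [h₂, hx, hy, lie_zero, lie_zero, lie_zero, sub_zero, add_zero] }
  have hM : ∀ x, x ∈ M ↔ β x = 0 := fun _ => Iff.rfl
  refine ⟨M, isComplement_iff.2 ⟨fun x => ?_, fun x => ⟨fun hx => ?_, fun hx => ⟨h.le hx, ?_⟩⟩⟩⟩
  · obtain ⟨a, ha⟩ := toFactor_surjective A B (φ.symm (β x))
    refine ⟨a, a.2, x - a, ?_, by abel⟩
    rw [hM, map_sub, hβ, ha, LieEquiv.apply_symm_apply, sub_self]
  · have e := (hM x).1 hx.2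
    have := hβ ⟨x, hx.1⟩
    rw [e] at this
    exact toFactor_eq_zero.1 (φ.injective (this.symm.trans (map_zero φ).symm))
  · rw [hM, hβ ⟨x, h.le hx⟩, toFactor_eq_zero.2 hx, map_zero]

theorem isNonabelian_of_equivalent {A B A' B' : LieIdeal K L} (hn : IsNonabelian A B)
    (he : (factorAlg A B).Equivalent (factorAlg A' B')) : IsNonabelian A' B' := by
  obtain ⟨φ, -⟩ := factorAlg_equivalent_iff.1 he
  refine fun h' => hn ⟨fun x y => φ.injective ?_⟩
  rw [LieHom.map_lie, h'.trivial, map_zero]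

/-! ### Maximal subalgebras that supplement or complement a chief factor. -/

section Frattini

theorem isCoatom_comap {B : LieIdeal K L} {M : LieSubalgebra K (L ⧸ B)} (hM : IsCoatom M) :
    IsCoatom (M.comap (quotMk B)) := by
  refine ⟨fun h => hM.1 ?_, fun T hT => ?_⟩
  · refine eq_top_iff.2 fun y _ => ?_
    obtain ⟨x, rfl⟩ := quotMk_surjective B y
    exact (h ▸ LieSubalgebra.mem_top x : x ∈ M.comap (quotMk B))
  · have hBT : ∀ x ∈ B, x ∈ T := fun x hx => hT.le (by
      rw [LieSubalgebra.mem_comap, quotMk_eq_zero.2 hx]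
      exact M.zero_mem)
    have hle : ∀ x, quotMk B x ∈ T.map (quotMk B) → x ∈ T := by
      rintro x hx
      obtain ⟨t, ht, htx⟩ := (LieSubalgebra.mem_map _ _ _).1 hx
      simpa using T.add_mem (hBT _ (quotMk_eq_iff.1 htx.symm)) ht
    have : T.map (quotMk B) = ⊤ := by
      refine hM.2 _ (lt_of_le_of_ne (fun y hy => ?_) fun h => hT.not_ge fun x hx => ?_)
      · obtain ⟨x, rfl⟩ := quotMk_surjective B y
        exact (LieSubalgebra.mem_map _ _ _).2 ⟨x, hT.le hy, rfl⟩
      · rw [LieSubalgebra.mem_comap, h]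
        exact (LieSubalgebra.mem_map _ _ _).2 ⟨x, hx, rfl⟩
    exact eq_top_iff.2 fun x _ => hle x (this ▸ LieSubalgebra.mem_top _)

theorem isSupplement_comap {A B : LieIdeal K L} (h : B ≤ A) {M : LieSubalgebra K (L ⧸ B)}
    (hM : IsCoatom M) (hA : ∃ y ∈ factor A B, y ∉ M) :
    IsSupplement (M.comap (quotMk B)) A B := by
  refine (isSupplement_iff h).2 ⟨(isCoatom_comap hM).1,
    exists_add_of_isCoatom (isCoatom_comap hM) ?_, fun x hx => ?_⟩
  · obtain ⟨y, hy, hyM⟩ := hA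
    obtain ⟨a, ha, rfl⟩ := mem_factor.1 hy
    exact ⟨a, ha, hyM⟩
  · rw [LieSubalgebra.mem_comap, quotMk_eq_zero.2 hx]
    exact M.zero_mem

theorem IsChief.isFrattini_or {A B : LieIdeal K L} (h : IsChief A B) :
    IsFrattini A B ∨ ∃ M : LieSubalgebra K L, IsCoatom M ∧ IsSupplement M A B := by
  by_cases hf : ∀ M : LieSubalgebra K (L ⧸ B), IsCoatom M → (factor A B : Set (L ⧸ B)) ⊆ M
  · exact Or.inl ⟨h, le_sSup hf⟩
  · push Not at hf
    obtain ⟨M, hM, hA⟩ := hf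
    obtain ⟨y, hy, hyM⟩ := Set.not_subset.1 hA
    exact Or.inr ⟨_, isCoatom_comap hM, isSupplement_comap h.le hM ⟨y, hy, hyM⟩⟩

/-- An ideal that is not nilpotent avoids some maximal subalgebra. -/
theorem exists_isCoatom_of_not_isNilpotent [FiniteDimensional K L] {A : LieIdeal K L}
    (h : ¬ LieRing.IsNilpotent A) : ∃ M : LieSubalgebra K L, IsCoatom M ∧ ∃ x ∈ A, x ∉ M := by
  by_contra! hA
  refine h (LieSubalgebra.isNilpotent_of_forall_le_engel (R := K) A.toLieSubalgebra
    fun x hx => ?_)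
  have hx : x ∈ A := hx
  rcases eq_top_or_exists_le_coatom (LieSubalgebra.engel K x) with he | ⟨M, hM, hle⟩
  · rw [he]
    exact le_top
  · exfalso
    -- Fitting decomposition: the kernel of $(\operatorname{ad}x)^n$ lies in the Engel subalgebra,
    -- hence in $M$, and for $n\ge1$ its range lies in $A\subseteq M$. So $M=L$, a contradiction;
    -- every Engel subalgebra of an element of $A$ is $L$, and Engel's theorem applies.
    obtain ⟨n, hn, hn0⟩ := ((LieAlgebra.ad K L x).eventually_codisjoint_ker_pow_range_pow.and
      (Filter.eventually_ge_atTop 1)).exists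
    refine hM.1 (eq_top_iff.2 fun y _ => ?_)
    have hy : y ∈ LinearMap.ker (LieAlgebra.ad K L x ^ n) ⊔
        LinearMap.range (LieAlgebra.ad K L x ^ n) := by
      rw [codisjoint_iff.1 hn]
      exact Submodule.mem_top
    obtain ⟨a, ha, b, ⟨c, rfl⟩, rfl⟩ := Submodule.mem_sup.1 hy
    refine M.add_mem (hle ((LieSubalgebra.mem_engel_iff K x a).2 ⟨n, ha⟩)) (hA M hM _ ?_)
    obtain ⟨k, rfl⟩ := Nat.exists_eq_add_of_le' hn0
    rw [pow_succ', Module.End.mul_apply]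
    exact lie_mem_left K L A _ _ hx

/-- A nonzero nilpotent algebra has a nonzero centre, while a nonabelian chief factor has none. -/
theorem IsChief.not_isNilpotent [FiniteDimensional K L] {A B : LieIdeal K L} (h : IsChief A B)
    (hn : IsNonabelian A B) : ¬ LieRing.IsNilpotent (factor A B) := by
  intro hnil
  have : Nontrivial (factor A B) := by
    obtain ⟨a, ha, hB⟩ := Set.exists_of_ssubset (show (B : Set L) ⊂ A from h.lt)
    exact ⟨⟨toFactor A B ⟨a, ha⟩, 0, fun e => hB (toFactor_eq_zero.1 e)⟩⟩
  have := LieModule.nontrivial_max_triv_of_isNilpotent K (factor A B) (factor A B)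
  obtain ⟨⟨z, hz⟩, hz0⟩ := exists_ne (0 : LieModule.maxTrivSubmodule K (factor A B) (factor A B))
  obtain ⟨a, rfl⟩ := toFactor_surjective A B z
  refine hz0 (Subtype.ext (toFactor_eq_zero.2 ?_))
  rw [← h.centralizerIdeal_inf hn]
  refine ⟨fun b hb => ?_, a.2⟩
  have := (LieModule.mem_maxTrivSubmodule K _ _ _).1 hz (toFactor A B ⟨b, hb⟩)
  rw [← LieHom.map_lie, toFactor_eq_zero] at this
  rw [← lie_skew]
  exact B.neg_mem this

theorem IsChief.exists_isCoatom [FiniteDimensional K L] {A B : LieIdeal K L} (h : IsChief A B)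
    (hn : IsNonabelian A B) :
    ∃ M : LieSubalgebra K (L ⧸ B), IsCoatom M ∧ ∃ y ∈ factor A B, y ∉ M := by
  have : FiniteDimensional K (L ⧸ B) :=
    Module.Finite.of_surjective (quotMk B : L →ₗ[K] L ⧸ B) (quotMk_surjective B)
  exact exists_isCoatom_of_not_isNilpotent (h.not_isNilpotent hn)

theorem IsChief.exists_isSupplement [FiniteDimensional K L] {A B : LieIdeal K L}
    (h : IsChief A B) (hn : IsNonabelian A B) :
    ∃ M : LieSubalgebra K L, IsCoatom M ∧ IsSupplement M A B := by
  obtain ⟨M, hM, hA⟩ := h.exists_isCoatom hn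
  exact ⟨_, isCoatom_comap hM, isSupplement_comap h.le hM hA⟩

theorem le_centralizerIdeal_self {A B : LieIdeal K L} (h : ¬ IsNonabelian A B) :
    A ≤ centralizerIdeal A B := by
  rw [isNonabelian_iff] at h
  push Not at h
  exact h

/-- A supplement `M` of a chief factor `A / B` is a complement if `L = C_L(A / B) + M`. -/
theorem IsChief.isComplement_of_isSupplement {A B C : LieIdeal K L} (h : IsChief A B)
    (hC : C ≤ centralizerIdeal A B) {M : LieSubalgebra K L}
    (hCM : ∀ x, ∃ c ∈ C, ∃ m ∈ M, c + m = x) (hM : IsSupplement M A B) :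
    IsComplement M A B := by
  obtain ⟨h₁, h₂, h₃⟩ := (isSupplement_iff h.le).1 hM
  -- $[C,A]\subseteq B\subseteq M$ makes $A\cap M$ an ideal between $B$ and $A$; it is not $A$,
  -- since $M$ is proper.
  obtain ⟨N, hN⟩ := exists_ideal_inf (J := A) hCM (fun c hc a ha _ => h₃ _ (hC hc a ha))
  have hNB : N = B := by
    refine (h.eq_or_eq (fun x hx => (hN x).2 ⟨h.le hx, h₃ x hx⟩)
      (fun x hx => ((hN x).1 hx).1)).resolve_right ?_
    rintro rfl
    refine h₁ (eq_top_iff.2 fun x _ => ?_)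
    obtain ⟨a, ha, m, hm, rfl⟩ := h₂ x
    exact M.add_mem ((hN a).1 ha).2 hm
  exact isComplement_iff.2 ⟨h₂, fun x => by rw [← hN, hNB]⟩

/-- A complement `M` of a chief factor `A / B` is maximal if `L = C_L(A / B) + M`. -/
theorem IsChief.isCoatom_of_isComplement {A B C : LieIdeal K L} (h : IsChief A B)
    (hC : C ≤ centralizerIdeal A B) {M : LieSubalgebra K L}
    (hCM : ∀ x, ∃ c ∈ C, ∃ m ∈ M, c + m = x) (hM : IsComplement M A B) : IsCoatom M := by
  obtain ⟨h₁, h₂⟩ := isComplement_iff.1 hM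
  refine ⟨?_, fun T hT => by_contra fun hne => ?_⟩
  · rintro rfl
    exact h.lt.not_ge fun x hx => (h₂ x).1 ⟨hx, LieSubalgebra.mem_top x⟩
  · have hsup : ∀ J : LieIdeal K L, (∀ x, ∃ a ∈ J, ∃ m ∈ M, a + m = x) →
        ∀ x, ∃ a ∈ J, ∃ m ∈ T, a + m = x := fun J hJ x =>
      let ⟨a, ha, m, hm, e⟩ := hJ x
      ⟨a, ha, m, hT.le hm, e⟩
    -- A larger proper subalgebra would supplement, hence complement, $A/B$ as well, and nested
    -- complements coincide.
    have hs : IsSupplement T A B :=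
      (isSupplement_iff h.le).2 ⟨hne, hsup A h₁, fun x hx => hT.le ((h₂ x).2 hx).2⟩
    obtain ⟨-, h₃⟩ := isComplement_iff.1 (h.isComplement_of_isSupplement hC (hsup C hCM) hs)
    refine hT.not_ge fun x hx => ?_
    obtain ⟨a, ha, m, hm, rfl⟩ := h₁ x
    have haT : a ∈ T := by simpa using T.sub_mem hx (hT.le hm)
    exact M.add_mem ((h₂ a).2 ((h₃ a).1 ⟨ha, haT⟩)).2 hm

/-- An abelian factor is centralized by $A$ itself, so every complement of it is maximal. This
confines the exceptional diamonds to nonabelian factors. -/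
theorem IsChief.isM_of_isC {A B : LieIdeal K L} (h : IsChief A B) (hab : ¬ IsNonabelian A B)
    (hc : IsC A B) : IsM A B :=
  let ⟨M, hM⟩ := hc
  ⟨M, h.isCoatom_of_isComplement (le_centralizerIdeal_self hab) (isComplement_iff.1 hM).1 hM, hM⟩

end Frattini

/-! ### The ideals $I$ and $C$, and the data attached to an exceptional diamond. -/

theorem coe_centralizerIdeal (A B : LieIdeal K L) :
    (centralizerIdeal A B : Set L) = (factorAlg A B).centralizer := by
  ext x
  change (∀ a ∈ A, ⁅x, a⁆ ∈ B) ↔ ∀ y : factor A B, ⁅quotMk B x, y⁆ = 0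
  constructor
  · intro h y
    obtain ⟨a, rfl⟩ := toFactor_surjective A B y
    rw [quotMk_lie_toFactor, toFactor_eq_zero]
    exact h a a.2
  · intro h a ha
    have := h (toFactor A B ⟨a, ha⟩)
    rwa [quotMk_lie_toFactor, toFactor_eq_zero] at this

/-- An element acts on $A/B$ as $\operatorname{ad}a$ exactly when its difference with $a$
centralizes $A/B$. -/
theorem coe_centralizerIdeal_sup (A B : LieIdeal K L) :
    ((centralizerIdeal A B ⊔ A : LieIdeal K L) : Set L) = (factorAlg A B).innerSet := by
  ext x
  change x ∈ centralizerIdeal A B ⊔ A ↔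
    ∃ z : factor A B, ∀ y : factor A B, ⁅quotMk B x, y⁆ = ⁅z, y⁆
  rw [LieSubmodule.mem_sup]
  constructor
  · rintro ⟨c, hc, a, ha, rfl⟩
    refine ⟨toFactor A B ⟨a, ha⟩, fun y => ?_⟩
    obtain ⟨b, rfl⟩ := toFactor_surjective A B y
    rw [quotMk_lie_toFactor, ← LieHom.map_lie, ← sub_eq_zero, ← map_sub, toFactor_eq_zero]
    change ⁅c + a, (b : L)⁆ - ⁅a, (b : L)⁆ ∈ B
    rw [add_lie, add_sub_cancel_right]
    exact hc b b.2
  · rintro ⟨z, hz⟩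
    obtain ⟨a, rfl⟩ := toFactor_surjective A B z
    refine ⟨x - a, fun b hb => ?_, a, a.2, sub_add_cancel x _⟩
    have := hz (toFactor A B ⟨b, hb⟩)
    rw [quotMk_lie_toFactor, ← LieHom.map_lie, ← sub_eq_zero, ← map_sub, toFactor_eq_zero] at this
    rw [sub_lie]
    exact this

/-- If `I / C` is a chief factor with centralizer `C`, every nonzero ideal of `L / C` contains
it. -/
theorem IsChief.factor_le {I C : LieIdeal K L} (h : IsChief I C) (hC : centralizerIdeal I C ≤ C)
    {J : LieIdeal K (L ⧸ C)} (hJ : J ≠ ⊥) : factor I C ≤ J := by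
  let J' := J.comap (quotMk C)
  have hJ' : ∀ x, x ∈ J' ↔ quotMk C x ∈ J := fun _ => LieIdeal.mem_comap
  have hle : C ≤ J' := fun x hx => by
    rw [hJ', quotMk_eq_zero.2 hx]
    exact J.zero_mem
  -- If the preimage of $J$ meets $I$ in $C$, it centralizes $I/C$, so it lies in $C$ and $J=0$.
  rcases h.eq_or_eq (le_inf hle h.le) inf_le_right with he | he
  · exfalso
    refine hJ ((LieSubmodule.eq_bot_iff J).2 fun y hy => ?_)
    obtain ⟨x, rfl⟩ := quotMk_surjective C y
    refine quotMk_eq_zero.2 (hC fun a ha => ?_)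
    rw [← he]
    exact ⟨lie_mem_left K L J' _ _ hy, lie_mem_right K L I _ _ ha⟩
  · exact LieIdeal.map_le_iff_le_comap.2 (inf_eq_right.1 he)

/-- Every nonzero ideal of $L/C$ contains $I/C$, so a maximal subalgebra not containing $I/C$ is
core-free. -/
theorem IsChief.isPrimitiveType2 [FiniteDimensional K L] {I C : LieIdeal K L} (h : IsChief I C)
    (hn : IsNonabelian I C) (hC : centralizerIdeal I C ≤ C) :
    IsPrimitiveType2 K (L ⧸ C) ∧ socle K (L ⧸ C) = factor I C := by
  have hne : factor I C ≠ ⊥ := by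
    intro e
    obtain ⟨a, ha, hB⟩ := Set.exists_of_ssubset (show (C : Set L) ⊂ I from h.lt)
    exact hB (quotMk_eq_zero.1 ((LieSubmodule.eq_bot_iff _).1 e _ (LieIdeal.mem_map ha)))
  have hatom : IsAtom (factor I C) :=
    ⟨hne, fun J hJ => by_contra fun hJ0 => hJ.not_ge (h.factor_le hC hJ0)⟩
  have huniq : ∀ J : LieIdeal K (L ⧸ C), IsAtom J → J = factor I C := fun J hJ =>
    ((hJ.le_iff.1 (h.factor_le hC hJ.1)).resolve_left hne).symm
  refine ⟨⟨?_, factor I C, hatom, huniq, hn⟩, le_antisymm (sSup_le fun J hJ => (huniq J hJ).le)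
    (le_sSup hatom)⟩
  obtain ⟨M, hM, y, hy, hyM⟩ := h.exists_isCoatom hn
  exact ⟨M, hM, fun J hJ => by_contra fun hJ0 => hyM (hJ (h.factor_le hC hJ0 hy))⟩

open LieAlgebra in
/-- If `M` complements `A / B` and `C` is an ideal meeting `A` in `B`, then
`L / (C ∩ M)` is the natural semi-direct sum of `(C + A) / C` by `(C + M) / C`. -/
theorem nonempty_equiv_factorSemiSum {A B C N : LieIdeal K L} {M : LieSubalgebra K L}
    (hM : IsComplement M A B) (hCA : C ⊓ A = B) (hN : ∀ x, x ∈ N ↔ x ∈ C ∧ x ∈ M) :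
    Nonempty ((L ⧸ N) ≃ₗ⁅K⁆ FactorSemiSum (C ⊔ A) C (supSubalgebra C M)) := by
  obtain ⟨h₁, h₂⟩ := isComplement_iff.1 hM
  have hBC : B ≤ C := hCA ▸ inf_le_left
  obtain ⟨p, hpA, hpM⟩ := exists_projection (J := C ⊔ A) (Q := C) h₁ le_sup_right
    (fun x hx hxM => hBC ((h₂ x).1 ⟨hx, hxM⟩))
  have hA : ∀ a ∈ A, (p a : L ⧸ C) = quotMk C a := fun a ha => by rw [hpA a ha]; rfl
  let r : L → L ⧸ C := fun x => quotMk C x - p x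
  have hr : ∀ a ∈ A, ∀ m ∈ M, r (a + m) = quotMk C m := fun a ha m hm => by
    change quotMk C (a + m) - (p (a + m) : L ⧸ C) = _
    rw [map_add p, hpM m hm, add_zero, hA a ha, map_add, add_sub_cancel_left]
  have hp : ∀ a ∈ A, ∀ m ∈ M, (p (a + m) : L ⧸ C) = quotMk C a := fun a ha m hm => by
    rw [map_add p, hpM m hm, add_zero, hA a ha]
  have hrF : ∀ x, r x ∈ (supSubalgebra C M).map (quotMk C) := fun x => by
    obtain ⟨a, ha, m, hm, rfl⟩ := h₁ x
    rw [hr a ha m hm]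
    exact (LieSubalgebra.mem_map _ _ _).2 ⟨m, le_supSubalgebra hm, rfl⟩
  -- The map is $a+m\mapsto(a+C,m+C)$ for $a\in A$, $m\in M$. Its kernel is $(A\cap C)+(M\cap
  -- C)=B+N=N$.
  let q : L →ₗ⁅K⁆ FactorSemiSum (C ⊔ A) C (supSubalgebra C M) :=
    { toFun := fun x => ⟨p x, ⟨r x, hrF x⟩⟩
      map_add' := fun x y => by
        refine SemiDirectSum.ext (map_add p x y) (Subtype.ext ?_)
        change quotMk C (x + y) - (p (x + y) : L ⧸ C) =
          (quotMk C x - (p x : L ⧸ C)) + (quotMk C y - (p y : L ⧸ C))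
        rw [map_add, map_add, LieSubmodule.coe_add]
        abel
      map_smul' := fun c x => by
        refine SemiDirectSum.ext (map_smul p c x) (Subtype.ext ?_)
        change quotMk C (c • x) - (p (c • x) : L ⧸ C) = c • (quotMk C x - (p x : L ⧸ C))
        rw [map_smul, map_smul, LieSubmodule.coe_smul, smul_sub]
      map_lie' := fun {x y} => by
        obtain ⟨a, ha, m, hm, rfl⟩ := h₁ x
        obtain ⟨b, hb, n, hn, rfl⟩ := h₁ y
        have e : ⁅a + m, b + n⁆ = (⁅a, b⁆ + ⁅a, n⁆ + ⁅m, b⁆) + ⁅m, n⁆ := by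
          simp only [add_lie, lie_add]
          abel
        have hab : ⁅a, b⁆ + ⁅a, n⁆ + ⁅m, b⁆ ∈ A :=
          A.add_mem (A.add_mem (lie_mem_left K L A _ _ ha) (lie_mem_left K L A _ _ ha))
            (lie_mem_right K L A _ _ hb)
        have hmn := M.lie_mem hm hn
        refine SemiDirectSum.ext (Subtype.ext ?_) (Subtype.ext ?_)
        · change (p ⁅a + m, b + n⁆ : L ⧸ C) = ⁅(p (a + m) : L ⧸ C), (p (b + n) : L ⧸ C)⁆ +
            ⁅r (a + m), (p (b + n) : L ⧸ C)⁆ - ⁅r (b + n), (p (a + m) : L ⧸ C)⁆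
          rw [e, hp _ hab _ hmn, hp a ha m hm, hp b hb n hn, hr a ha m hm, hr b hb n hn,
            ← LieHom.map_lie, ← LieHom.map_lie, ← LieHom.map_lie, ← lie_skew a n, map_add,
            map_add, map_neg]
          abel
        · change r ⁅a + m, b + n⁆ = ⁅r (a + m), r (b + n)⁆
          rw [e, hr _ hab _ hmn, hr a ha m hm, hr b hb n hn, LieHom.map_lie] }
  have hq : ∀ a (ha : a ∈ A) m (hm : m ∈ M), q (a + m) = 0 ↔ a ∈ C ∧ m ∈ C := by
    intro a ha m hm
    rw [← quotMk_eq_zero, ← quotMk_eq_zero, ← hp a ha m hm, ← hr a ha m hm]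
    constructor
    · intro h
      exact ⟨congrArg (fun z => (z.left : L ⧸ C)) h, congrArg (fun z => (z.right : L ⧸ C)) h⟩
    · intro h
      exact SemiDirectSum.ext (Subtype.ext h.1) (Subtype.ext h.2)
  obtain ⟨e, -⟩ := exists_lieEquiv_of_surjective (quotMk N) q (quotMk_surjective N) (by
      rintro ⟨⟨y, hy⟩, ⟨z, hz⟩⟩
      obtain ⟨i, hi, rfl⟩ := mem_factor.1 hy
      obtain ⟨f, hf, rfl⟩ := (LieSubalgebra.mem_map _ _ _).1 hz
      obtain ⟨c, hc, a, ha, rfl⟩ := (LieSubmodule.mem_sup _ _ _).1 hi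
      obtain ⟨d, hd, m, hm, rfl⟩ := mem_supSubalgebra.1 hf
      refine ⟨a + m, SemiDirectSum.ext (Subtype.ext ((hp a ha m hm).trans ?_))
        (Subtype.ext ((hr a ha m hm).trans ?_))⟩
      · change quotMk C a = quotMk C (c + a)
        rw [map_add, quotMk_eq_zero.2 hc, zero_add]
      · change quotMk C m = quotMk C (d + m)
        rw [map_add, quotMk_eq_zero.2 hd, zero_add])
    (fun x => by
      obtain ⟨a, ha, m, hm, rfl⟩ := h₁ x
      rw [hq a ha m hm, quotMk_eq_zero, hN]
      constructor
      · rintro ⟨h, h'⟩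
        have haM : a ∈ M := by
          have : a + m - m ∈ M := M.sub_mem h' hm
          simpa using this
        have haC : a ∈ C := hBC ((h₂ a).1 ⟨ha, haM⟩)
        refine ⟨haC, ?_⟩
        simpa using C.sub_mem h haC
      · rintro ⟨h, h'⟩
        have haB : a ∈ B := hCA ▸ ⟨h, ha⟩
        exact ⟨C.add_mem h h', M.add_mem ((h₂ a).2 haB).2 hm⟩)
  exact ⟨e⟩

/-- Everything comes from one complement $M$ of $W/D$: with $C$ the centralizer of $W/D$, take
$I=C+W$, $N=C\cap M$, $X=N+W$ and $F=C+M$. The same $M$ complements $X/N$, whereas $I/C$ lies above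
$U/V$ and so cannot be complemented. -/
theorem exists_crossingData [FiniteDimensional K L] {U V W D : LieIdeal K L} (h : Down U V W D)
    (hn : IsNonabelian W D) (hc : IsC W D) (hnc : ¬ IsC U V) (hm : ¬ IsM W D) :
    ∃ I C X N, CrossingData U V W D I C X N := by
  obtain ⟨M, hM⟩ := hc
  obtain ⟨h₁, h₂⟩ := isComplement_iff.1 hM
  have hWD : IsChief W D := h.2.1
  set C := centralizerIdeal W D
  have hCW : C ⊓ W = D := hWD.centralizerIdeal_inf hn
  have hDC : D ≤ C := le_centralizerIdeal W D
  obtain ⟨N, hN⟩ := exists_ideal_inf (J := C) h₁ (fun w hw c hc _ => by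
    rw [← lie_skew]
    exact M.neg_mem ((h₂ _).2 (hc w hw)).2)
  have hNC : N ≤ C := fun x hx => ((hN x).1 hx).1
  have hDN : D ≤ N := fun x hx => (hN x).2 ⟨hDC hx, ((h₂ x).2 hx).2⟩
  have hNW : N ⊓ W = D := le_antisymm (hCW ▸ inf_le_inf_right W hNC) (le_inf hDN hWD.le)
  have hIC : IsChief (C ⊔ W) C := covBy_sup_of_inf_covBy_right (by rw [hCW]; exact hWD)
  have hXN : IsChief (N ⊔ W) N := covBy_sup_of_inf_covBy_right (by rw [hNW]; exact hWD)
  have hCX : C ⊓ (N ⊔ W) = N := by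
    rw [inf_comm, sup_inf_assoc_of_le W hNC, inf_comm W, hCW, sup_eq_left.2 hDN]
  have hVC : V ≤ C := fun v hv w hw => h.lie_mem hv hw
  have hCU : C ⊓ U = V := by
    refine (h.1.eq_or_eq (le_inf hVC h.1.le) inf_le_right).resolve_right fun e => ?_
    have hWC : W ≤ C := h.le_left.trans (inf_eq_right.1 e)
    exact hWD.lt.ne' ((inf_eq_right.2 hWC).symm.trans hCW)
  have hIU : C ⊔ W = C ⊔ U := by
    rw [h.2.2.1, ← sup_assoc, sup_eq_left.2 hVC]
  have hdown : Down (C ⊔ W) C U V := ⟨hIC, h.1, hIU, hCU⟩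
  have hIX : Down (C ⊔ W) C (N ⊔ W) N :=
    ⟨hIC, hXN, by rw [← sup_assoc, sup_eq_left.2 hNC], hCX⟩
  have hIW : Down (C ⊔ W) C W D := ⟨hIC, hWD, rfl, hCW⟩
  refine ⟨C ⊔ W, C, N ⊔ W, N,
    { down := h
      nonabelian_top := isNonabelian_of_equivalent hn h.equivalent
      nonabelian_bot := hn
      not_c := hnc
      isC := ⟨M, hM⟩
      I_eq := coe_centralizerIdeal_sup W D
      C_eq := coe_centralizerIdeal W D
      one := ⟨hdown, fun hI => hnc (hdown.isC hI)⟩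
      two := ⟨sup_le_sup_right hNC W, (inf_comm _ _).trans hCX |>.symm, ⟨hXN, hWD, rfl, hNW⟩, hIX,
        M, ?_⟩
      three := ⟨supSubalgebra C M, ?_, nonempty_equiv_factorSemiSum hM hCW hN⟩
      four := hIC.isPrimitiveType2 (isNonabelian_of_equivalent hn hIW.equivalent) ?_ }⟩
  · refine isComplement_iff.2 ⟨fun x => ?_, fun x => ⟨fun hx => ?_, fun hx => ?_⟩⟩
    · obtain ⟨w, hw, m, hm, rfl⟩ := h₁ x
      exact ⟨w, LieSubmodule.mem_sup_right hw, m, hm, rfl⟩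
    · obtain ⟨n, hn, w, hw, rfl⟩ := (LieSubmodule.mem_sup _ _ _).1 hx.1
      have hwM : w ∈ M := by
        have : n + w - n ∈ M := M.sub_mem hx.2 ((hN n).1 hn).2
        simpa using this
      exact N.add_mem hn (hDN ((h₂ w).1 ⟨hw, hwM⟩))
    · exact ⟨LieSubmodule.mem_sup_left hx, ((hN x).1 hx).2⟩
  · refine (isSupplement_iff hIC.le).2 ⟨fun htop => hm ⟨M, ?_, hM⟩, fun x => ?_, fun x hx =>
      left_mem_supSubalgebra hx⟩
    -- $F$ is proper: $L=C+M$ would make $M$ a maximal complement of $W/D$.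
    · refine hWD.isCoatom_of_isComplement le_rfl (fun x => ?_) hM
      exact mem_supSubalgebra.1 (htop ▸ LieSubalgebra.mem_top x)
    · obtain ⟨w, hw, m, hm, rfl⟩ := h₁ x
      exact ⟨w, LieSubmodule.mem_sup_right hw, m, le_supSubalgebra hm, rfl⟩
  · intro x hx w hw
    rw [← hCW]
    exact ⟨hx w (LieSubmodule.mem_sup_right hw), lie_mem_right K L W _ _ hw⟩

/-! ### Sums over maximal chains in a modular lattice. -/

section Order

/-- `CoverSum f a s`: the sum of `f` over the covers of some maximal chain from `⊥` to `a`
is `s`. -/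
inductive CoverSum {α : Type*} [PartialOrder α] [OrderBot α] (f : α → α → ℤ) : α → ℤ → Prop
  | bot : CoverSum f ⊥ 0
  | step {a b : α} {s : ℤ} : CoverSum f b s → b ⋖ a → CoverSum f a (s + f a b)

theorem CoverSum.exists {α : Type*} [PartialOrder α] [OrderBot α] [WellFoundedLT α]
    [WellFoundedGT α] (f : α → α → ℤ) (a : α) : ∃ s, CoverSum f a s := by
  obtain ⟨c, h₀, n, hn, hc⟩ :=
    exists_covBy_seq_of_wellFoundedLT_wellFoundedGT_of_le (bot_le : ⊥ ≤ a)
  have : ∀ i ≤ n, ∃ s, CoverSum f (c i) s := by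
    intro i
    induction i with
    | zero => exact fun _ => ⟨0, h₀ ▸ CoverSum.bot⟩
    | succ i ih =>
      intro hi
      obtain ⟨s, hs⟩ := ih (Nat.le_of_succ_le hi)
      exact ⟨_, hs.step (hc i hi)⟩
  exact hn ▸ this n le_rfl

/-- A function on covers that is additive on diamonds of a modular lattice has the same sum over
any two maximal chains. -/
theorem CoverSum.unique {α : Type*} [Lattice α] [OrderBot α] [IsModularLattice α]
    [WellFoundedLT α] [WellFoundedGT α] {f : α → α → ℤ}
    (hf : ∀ u v w, v ⋖ u → w ⋖ u → v ≠ w → f u v + f v (v ⊓ w) = f u w + f w (v ⊓ w)) (a : α) :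
    ∀ s t, CoverSum f a s → CoverSum f a t → s = t := by
  induction a using WellFoundedLT.induction with
  | ind a ih =>
    intro s t hs ht
    cases hs with
    | bot =>
      cases ht with
      | bot => rfl
      | step _ h => exact absurd h.lt not_lt_bot
    | @step _ b s hs hb =>
      cases ht with
      | bot => exact absurd hb.lt not_lt_bot
      | @step _ c t ht hc =>
        by_cases hbc : b = c
        · subst hbc
          rw [ih b hb.lt s t hs ht]
        · have hsup : b ⊔ c = a :=
            ((hb.eq_or_eq le_sup_left (sup_le hb.le hc.le)).resolve_left fun e =>
              (hc.eq_or_eq (sup_eq_left.1 e) hb.le).elim hbc fun e' => hb.lt.ne e')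
          have h₁ : b ⊓ c ⋖ b := inf_covBy_of_covBy_sup_right (hsup.symm ▸ hc)
          have h₂ : b ⊓ c ⋖ c := inf_covBy_of_covBy_sup_left (hsup.symm ▸ hb)
          -- Jordan–Hölder induction: both chains are compared with chains through $b\wedge c$, and
          -- the diamond identity joins the two comparisons.
          obtain ⟨r, hr⟩ := CoverSum.exists f (b ⊓ c)
          have e₁ := ih b hb.lt _ _ hs (hr.step h₁)
          have e₂ := ih c hc.lt _ _ ht (hr.step h₂)
          have := hf a b c hb hc hbc
          linarith

end Order

/-! ### Counting equivalence classes along chief series. -/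

theorem covBy_diamond {U V W : LieIdeal K L} (hV : V ⋖ U) (hW : W ⋖ U) (hne : V ≠ W) :
    Down U V W (V ⊓ W) := by
  have hsup : V ⊔ W = U :=
    ((hV.eq_or_eq le_sup_left (sup_le hV.le hW.le)).resolve_left fun e =>
      (hW.eq_or_eq (sup_eq_left.1 e) hV.le).elim hne fun e' => hV.lt.ne e')
  exact ⟨hV, inf_covBy_of_covBy_sup_left (hsup.symm ▸ hV), hsup.symm, rfl⟩

/-- The sum of a function over the factors of a chief series. -/
def ChiefSeries.sum (X : ChiefSeries K L) (f : LieIdeal K L → LieIdeal K L → ℤ) : ℤ :=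
  ∑ i : Fin X.length, f (X.ideal i.succ) (X.ideal i.castSucc)

theorem ChiefSeries.coverSum (X : ChiefSeries K L) (f : LieIdeal K L → LieIdeal K L → ℤ) :
    CoverSum f ⊤ (X.sum f) := by
  have : ∀ k (hk : k ≤ X.length), CoverSum f (X.ideal ⟨k, Nat.lt_succ_of_le hk⟩)
      (∑ i : Fin k, f (X.ideal (i.castLE hk).succ) (X.ideal (i.castLE hk).castSucc)) := by
    intro k
    induction k with
    | zero =>
      intro hk
      have h0 : X.ideal ⟨0, Nat.lt_succ_of_le hk⟩ = ⊥ := X.bot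
      rw [h0, Finset.univ_eq_empty, Finset.sum_empty]
      exact CoverSum.bot
    | succ k ih =>
      intro hk
      rw [Fin.sum_univ_castSucc]
      exact (ih (Nat.le_of_succ_le hk)).step (X.chief ⟨k, hk⟩)
  have h := this X.length le_rfl
  rw [← X.top]
  exact h

/-- The `L`-equivalence class of the factor `A / B`. -/
def factorClass (A B : LieIdeal K L) : Quotient (lAlgSetoid K L) :=
  Quotient.mk (lAlgSetoid K L) (factorAlg A B)

theorem factorClass_eq_iff {A B C D : LieIdeal K L} :
    factorClass A B = factorClass C D ↔ (factorAlg A B).Equivalent (factorAlg C D) :=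
  Quotient.eq (r := lAlgSetoid K L)

theorem Down.factorClass_eq {A B C D : LieIdeal K L} (h : Down A B C D) :
    factorClass A B = factorClass C D :=
  factorClass_eq_iff.2 h.equivalent.symm

open Classical in
/-- The indicator function of the complemented factors in the class `q`. -/
noncomputable def complementedIndicator (q : Quotient (lAlgSetoid K L)) (A B : LieIdeal K L) : ℤ :=
  if factorClass A B = q ∧ IsC A B then 1 else 0

open Classical in
/-- The indicator function of the factors in the class `q`. -/
noncomputable def classIndicator (q : Quotient (lAlgSetoid K L)) (A B : LieIdeal K L) : ℤ :=
  if factorClass A B = q then 1 else 0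

theorem ChiefSeries.sum_classIndicator [FiniteDimensional K L] (X Y : ChiefSeries K L)
    (q : Quotient (lAlgSetoid K L)) :
    X.sum (classIndicator q) =
      Y.sum (classIndicator q) := by
  have : WellFoundedLT (LieIdeal K L) := LieSubmodule.wellFoundedLT_of_isArtinian K L L
  refine CoverSum.unique (fun U V W hV hW hne => ?_) ⊤ _ _ (X.coverSum _) (Y.coverSum _)
  have h := covBy_diamond hV hW hne
  have h' := covBy_diamond hW hV hne.symm
  rw [inf_comm] at h'
  unfold classIndicator
  rw [h.factorClass_eq, h'.factorClass_eq, add_comm]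

/-- If `W / D` is complemented by a maximal subalgebra and `U / V` is not complemented, then `V / D`
is complemented, `U / W` is not, and all four factors are equivalent. -/
theorem Down.of_isM {U V W D : LieIdeal K L} (h : Down U V W D) (h' : Down U W V D)
    (hm : IsM W D) (hnc : ¬ IsC U V) :
    factorClass W D = factorClass V D ∧ IsC V D ∧ ¬ IsC U W := by
  obtain ⟨M, hc, hM⟩ := hm
  have hV : ∃ x ∈ V, x ∉ M := by
    by_contra! hV
    exact hnc ⟨M, hM.of_le h hV⟩
  have hMV := hM.of_not_le h h'.2.1 hc hV
  exact ⟨factorClass_eq_iff.2 (equivalent_of_common_complement h hM hMV), ⟨M, hMV⟩,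
    fun hUW => hnc (isC_of_common_complement h hM hMV hUW)⟩

/-- Complements pass downwards, so opposite sides can differ only if the lower one is complemented
and the upper one is not. The hypotheses then supply a maximal complement, and by `Down.of_isM` the
other pair of sides differs in the same way, restoring the balance. -/
theorem complementedIndicator_diamond {q : Quotient (lAlgSetoid K L)} {U V W D : LieIdeal K L}
    (h : Down U V W D) (h' : Down U W V D)
    (hVW : factorClass U V = q → ¬ IsC U V → IsC W D → IsM W D)
    (hWV : factorClass U W = q → ¬ IsC U W → IsC V D → IsM V D) :
    complementedIndicator q U V + complementedIndicator q V D =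
      complementedIndicator q U W + complementedIndicator q W D := by
  have hV : factorClass W D = q → ¬ IsC U V → IsC W D →
      factorClass V D = q ∧ IsC V D ∧ ¬ IsC U W := fun e hnc hc => by
    have := h.of_isM h' (hVW (h.factorClass_eq.trans e) hnc hc) hnc
    exact ⟨this.1.symm.trans e, this.2⟩
  have hW : factorClass V D = q → ¬ IsC U W → IsC V D →
      factorClass W D = q ∧ IsC W D ∧ ¬ IsC U V := fun e hnc hc => by
    have := h'.of_isM h (hWV (h'.factorClass_eq.trans e) hnc hc) hnc
    exact ⟨this.1.symm.trans e, this.2⟩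
  have hd := h.isC
  have hd' := h'.isC
  unfold complementedIndicator
  rw [h.factorClass_eq, h'.factorClass_eq]
  clear hVW hWV h h'
  by_cases h₁ : factorClass W D = q <;> by_cases h₂ : factorClass V D = q <;>
     by_cases h₃ : IsC U V <;> by_cases h₄ : IsC U W <;>
    by_cases h₅ : IsC W D <;> by_cases h₆ : IsC V D <;> simp_all

/-! ### From an exceptional diamond to $cc'$-type. -/

theorem mRelated_self {A B : LieIdeal K L} (h : IsChief A B) : MRelated A B A B := by
  rcases h.isFrattini_or with hf | ⟨M, -, hM⟩
  · exact Or.inr (Or.inr (Or.inl ⟨A, B, hf, h.down_self, h.down_self⟩))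
  · exact Or.inl ⟨A, B, ⟨M, hM⟩, h.down_self, h.down_self⟩

theorem Down.mRelated_of_isNonabelian [FiniteDimensional K L] {A B C D : LieIdeal K L}
    (h : Down A B C D) (hn : IsNonabelian A B) : MRelated A B C D ∧ MRelated C D A B := by
  obtain ⟨M, -, hM⟩ := h.1.exists_isSupplement hn
  exact ⟨Or.inl ⟨A, B, ⟨M, hM⟩, h.1.down_self, h⟩, Or.inl ⟨A, B, ⟨M, hM⟩, h, h.1.down_self⟩⟩

/-- The nonabelian case uses a supplement of $U/W$. In the abelian case, if $V/D$ is not Frattini,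
it has a maximal complement $M$. Then $W\subseteq M$, since otherwise $M$ would complement $W/D$
too; so $M$ supplements $U/W$. -/
theorem Down.mRelated_of_not_isM [FiniteDimensional K L] {U V W D : LieIdeal K L}
    (h : Down U V W D) (h' : Down U W V D) (hm : ¬ IsM W D) : MRelated V D U W := by
  by_cases hn : IsNonabelian U W
  · exact (h'.mRelated_of_isNonabelian hn).2
  have hn' : ¬ IsNonabelian V D := fun hV => hn (isNonabelian_of_equivalent hV h'.equivalent)
  rcases h'.2.1.isFrattini_or with hf | ⟨M, hc, hM⟩
  · exact Or.inr (Or.inr (Or.inl ⟨V, D, hf, h'.2.1.down_self, h'⟩))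
  · have hMV := h'.2.1.isComplement_of_isSupplement (le_centralizerIdeal_self hn')
      ((isSupplement_iff h'.2.1.le).1 hM).2.1 hM
    by_cases hW : ∃ x ∈ W, x ∉ M
    · exact absurd ⟨M, hc, hMV.of_not_le h' h.2.1 hc hW⟩ hm
    · push Not at hW
      obtain ⟨h₁, h₂⟩ := isComplement_iff.1 (hMV.of_le h' hW)
      exact Or.inl ⟨U, W, ⟨M, (isSupplement_iff h'.1.le).2 ⟨hc.1, h₁, hW⟩⟩, h',
        h'.1.down_self⟩

theorem IsChief.isIrreducible {A B : LieIdeal K L} (h : IsChief A B) :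
    (factorAlg A B).IsIrreducible := by
  change Nontrivial (factor A B) ∧ ∀ V : Submodule K (factor A B),
    (∀ (x : L), ∀ y ∈ V, ⁅quotMk B x, y⁆ ∈ V) → V = ⊥ ∨ V = ⊤
  constructor
  · obtain ⟨a, ha, hB⟩ := Set.exists_of_ssubset (show (B : Set L) ⊂ A from h.lt)
    exact ⟨⟨toFactor A B ⟨a, ha⟩, 0, fun e => hB (toFactor_eq_zero.1 e)⟩⟩
  · intro V hV
    let J : LieIdeal K L :=
      { (V.comap (toFactor A B : A →ₗ[K] factor A B)).map A.toSubmodule.subtype with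
        lie_mem := by
          rintro x _ ⟨y, hy, rfl⟩
          let z : A := y
          refine ⟨(⁅x, z⁆ : A), ?_, rfl⟩
          change toFactor A B ⁅x, z⁆ ∈ V
          have := hV x (toFactor A B z) hy
          rwa [quotMk_lie_toFactor] at this }
    have hJ : ∀ a : A, (a : L) ∈ J ↔ toFactor A B a ∈ V := fun a =>
      ⟨fun ⟨_, hb, e⟩ => Subtype.ext e ▸ hb, fun ha => ⟨a, ha, rfl⟩⟩
    rcases h.eq_or_eq (J := J) (fun x hx => (hJ ⟨x, h.le hx⟩).2 (by
      rw [toFactor_eq_zero.2 hx]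
      exact V.zero_mem)) (by rintro _ ⟨y, -, rfl⟩; exact y.2) with e | e
    · refine Or.inl ((Submodule.eq_bot_iff V).2 fun y hy => ?_)
      obtain ⟨a, rfl⟩ := toFactor_surjective A B y
      exact toFactor_eq_zero.2 (e.le ((hJ a).2 hy))
    · refine Or.inr (Submodule.eq_top_iff'.2 fun y => ?_)
      obtain ⟨a, rfl⟩ := toFactor_surjective A B y
      exact (hJ a).1 (e.ge a.2)

/-- The chief series given by an initial segment of a sequence of ideals. -/
def ChiefSeries.ofSeq (c : ℕ → LieIdeal K L) (n : ℕ) (h₀ : c 0 = ⊥) (hn : c n = ⊤)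
    (h : ∀ i < n, c i ⋖ c (i + 1)) : ChiefSeries K L where
  length := n
  ideal i := c i
  bot := h₀
  top := hn
  chief i := h i i.2

theorem exists_chiefSeries [FiniteDimensional K L] : Nonempty (ChiefSeries K L) := by
  have : WellFoundedLT (LieIdeal K L) := LieSubmodule.wellFoundedLT_of_isArtinian K L L
  obtain ⟨c, h₀, n, hn, hc⟩ :=
    exists_covBy_seq_of_wellFoundedLT_wellFoundedGT_of_le (bot_le : (⊥ : LieIdeal K L) ≤ ⊤)
  exact ⟨ChiefSeries.ofSeq c n h₀ hn hc⟩

/-- There is a maximal chain of ideals through `D` and `U`, with one step left open between them. -/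
theorem exists_seq_through [FiniteDimensional K L] (D U : LieIdeal K L) :
    ∃ (c : ℕ → LieIdeal K L) (k n : ℕ), k + 2 ≤ n ∧ c 0 = ⊥ ∧ c n = ⊤ ∧ c k = D ∧ c (k + 2) = U ∧
      ∀ i < n, i ≠ k → i ≠ k + 1 → c i ⋖ c (i + 1) := by
  have : WellFoundedLT (LieIdeal K L) := LieSubmodule.wellFoundedLT_of_isArtinian K L L
  obtain ⟨a, ha₀, k, hk, ha⟩ :=
    exists_covBy_seq_of_wellFoundedLT_wellFoundedGT_of_le (bot_le : ⊥ ≤ D)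
  obtain ⟨b, hb₀, l, hl, hb⟩ :=
    exists_covBy_seq_of_wellFoundedLT_wellFoundedGT_of_le (le_top : U ≤ ⊤)
  refine ⟨fun i => if i ≤ k then a i else b (i - (k + 2)), k, k + 2 + l, by omega, ?_, ?_, ?_, ?_,
    fun i hi h₁ h₂ => ?_⟩ <;> beta_reduce
  · simpa using ha₀
  · rw [if_neg (by omega), Nat.add_sub_cancel_left, hl]
  · simpa using hk
  · simpa using hb₀
  · rcases lt_or_gt_of_ne h₁ with h | h
    · rw [if_pos h.le, if_pos (by omega)]
      exact ha i h
    · rw [if_neg (by omega), if_neg (by omega)]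
      obtain ⟨j, rfl⟩ := Nat.exists_eq_add_of_le (show k + 2 ≤ i by omega)
      rw [Nat.add_sub_cancel_left, add_assoc, Nat.add_sub_cancel_left]
      exact hb j (by omega)

/-- A diamond in which `W / D` is complemented, but not by a maximal subalgebra, while `U / V` is not
complemented, exhibits the class of `U / V` as one of `cc'`-type. -/
theorem Down.factorClass_mem_ccClasses [FiniteDimensional K L] {U V W D : LieIdeal K L}
    (h : Down U V W D) (h' : Down U W V D) (hnc : ¬ IsC U V) (hc : IsC W D) (hm : ¬ IsM W D) :
    IsNonabelian U V ∧ factorClass U V ∈ ccClasses K L := by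
  have hn : IsNonabelian W D := by_contra fun hab => hm (h.2.1.isM_of_isC hab hc)
  have hn' : IsNonabelian U V := isNonabelian_of_equivalent hn h.equivalent
  refine ⟨hn', factorAlg U V, ⟨h.1.isIrreducible, ?_⟩, rfl⟩
  obtain ⟨c, k, n, hkn, h₀, htop, hD, hU, hcov⟩ := exists_seq_through D U
  have hpair : CCPair W D U V := by
    obtain ⟨I, C, X, N, hX⟩ := exists_crossingData h hn hc hnc hm
    -- The factor $B^*/B$ above both members of the pair is $U/V$ itself.
    exact ⟨hm, fun ⟨M, _, hM⟩ => hnc ⟨M, hM⟩, hn, hn', hc, hnc, U, V, I, C, X, N,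
      h.1.down_self, hX⟩
  have series : ∀ T : LieIdeal K L, D ⋖ T → T ⋖ U → ∃ X : ChiefSeries K L, X.length = n ∧
      ∀ i : Fin (X.length + 1), X.ideal i = Function.update c (k + 1) T i := by
    intro T h₁ h₂
    refine ⟨ChiefSeries.ofSeq (Function.update c (k + 1) T) n ?_ ?_ fun i hi => ?_, rfl,
      fun i => rfl⟩
    · rw [Function.update_of_ne (by omega), h₀]
    · rw [Function.update_of_ne (by omega), htop]
    · by_cases hk : i = k
      · subst hk
        rw [Function.update_of_ne (by omega), Function.update_self, hD]
        exact h₁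
      · by_cases hk' : i = k + 1
        · subst hk'
          rw [Function.update_self, Function.update_of_ne (by omega), hU]
          exact h₂
        · rw [Function.update_of_ne hk', Function.update_of_ne (by omega)]
          exact hcov i hi hk hk'
  obtain ⟨X, rfl, hX⟩ := series V h'.2.1 h.1
  obtain ⟨Y, hY', hY⟩ := series W h.2.1 h'.1
  let i₀ : Fin X.length := ⟨k, by omega⟩
  let i₁ : Fin X.length := ⟨k + 1, by omega⟩
  have hX₀ : X.ideal i₀.castSucc = D ∧ X.ideal i₀.succ = V := by
    rw [hX, hX]
    simp [i₀, hD]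
  have hX₁ : X.ideal i₁.castSucc = V ∧ X.ideal i₁.succ = U := by
    rw [hX, hX]
    simp [i₁, hU]
  let e : Fin X.length ≃ Fin Y.length := finCongr hY'.symm
  have hY₀ : Y.ideal (e i₀).castSucc = D ∧ Y.ideal (e i₀).succ = W := by
    rw [hY, hY]
    simp [i₀, e, hD]
  have hY₁ : Y.ideal (e i₁).castSucc = W ∧ Y.ideal (e i₁).succ = U := by
    rw [hY, hY]
    simp [i₁, e, hU]
  have hne : i₀ ≠ i₁ := by simp [i₀, i₁, Fin.ext_iff]
  -- The swap matches opposite sides, $U/V$ with $W/D$ and $V/D$ with $U/W$. The second alternative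
  -- is chosen because the $c'$-factor $U/V$ belongs to the first series.
  refine ⟨X, Y, (Equiv.swap i₀ i₁).trans e, fun i => ?_, i₁, ?_, Or.inr ?_⟩
  · rw [Equiv.trans_apply]
    by_cases hi₀ : i = i₀
    · subst hi₀
      rw [Equiv.swap_apply_left, hX₀.1, hX₀.2, hY₁.1, hY₁.2]
      exact h.mRelated_of_not_isM h' hm
    · by_cases hi₁ : i = i₁
      · subst hi₁
        rw [Equiv.swap_apply_right, hX₁.1, hX₁.2, hY₀.1, hY₀.2]
        exact (h.mRelated_of_isNonabelian hn').1
      · rw [Equiv.swap_apply_of_ne_of_ne hi₀ hi₁]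
        have h₁ : (i : ℕ) ≠ k := fun e => hi₀ (Fin.ext e)
        have h₂ : (i : ℕ) ≠ k + 1 := fun e => hi₁ (Fin.ext e)
        have e₁ : Y.ideal (e i).castSucc = X.ideal i.castSucc := by
          rw [hX, hY]
          simp [e, h₂]
        have e₂ : Y.ideal (e i).succ = X.ideal i.succ := by
          rw [hX, hY]
          simp [e, h₁]
        rw [e₁, e₂]
        exact mRelated_self (X.chief i)
  · rw [hX₁.1, hX₁.2]
    exact LAlg.Equivalent.refl _
  · rw [Equiv.trans_apply, Equiv.swap_apply_right, hX₁.1, hX₁.2, hY₀.1, hY₀.2]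
    exact hpair

/-- If the number of complemented factors in a class depends on the chief series, the class is
nonabelian and of `cc'`-type. -/
theorem mem_ccClasses_of_sum_ne [FiniteDimensional K L] {X Y : ChiefSeries K L}
    {q : Quotient (lAlgSetoid K L)}
    (h : X.sum (complementedIndicator q) ≠
      Y.sum (complementedIndicator q)) :
    q ∈ ccClasses K L ∧ ∃ A B : LieIdeal K L, IsNonabelian A B ∧ factorClass A B = q := by
  have : WellFoundedLT (LieIdeal K L) := LieSubmodule.wellFoundedLT_of_isArtinian K L L
  by_contra hq
  refine h (CoverSum.unique (fun U V W hV hW hne => ?_) ⊤ _ _ (X.coverSum _) (Y.coverSum _))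
  have hd := covBy_diamond hV hW hne
  have hd' := covBy_diamond hW hV hne.symm
  rw [inf_comm] at hd'
  refine complementedIndicator_diamond hd hd' (fun e hnc hc => by_contra fun hm => hq ?_)
    (fun e hnc hc => by_contra fun hm => hq ?_)
  · obtain ⟨hn, hmem⟩ := hd.factorClass_mem_ccClasses hd' hnc hc hm
    exact ⟨e ▸ hmem, U, V, hn, e⟩
  · obtain ⟨hn, hmem⟩ := hd'.factorClass_mem_ccClasses hd hnc hc hm
    exact ⟨e ▸ hmem, U, W, hn, e⟩

/-! ### Complemented factors within one class, and the final count. -/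

theorem ChiefSeries.monotone (X : ChiefSeries K L) : Monotone X.ideal :=
  Fin.monotone_iff_le_succ.2 fun i => (X.chief i).le

/-- In a chief series, a factor that is not complemented lies above all other factors in its
nonabelian class. -/
theorem ChiefSeries.le_of_not_isC (X : ChiefSeries K L) {i j : Fin X.length}
    (hn : IsNonabelian (X.ideal i.succ) (X.ideal i.castSucc))
    (he : factorClass (X.ideal i.succ) (X.ideal i.castSucc) =
      factorClass (X.ideal j.succ) (X.ideal j.castSucc))
    (hi : ¬ IsC (X.ideal i.succ) (X.ideal i.castSucc)) : j ≤ i := by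
  by_contra! hij
  -- If $i<j$, the top of the lower factor lies below the bottom of the upper one and so centralizes
  -- it.
  refine hi (isC_of_equivalent (X.chief i) hn (factorClass_eq_iff.1 he) ?_)
  have hle : X.ideal i.succ ≤ X.ideal j.castSucc := X.monotone hij
  exact hle.trans (le_centralizerIdeal _ _)

/-- Two uncomplemented factors of the class would each lie above the other by
`ChiefSeries.le_of_not_isC`, so there is at most one. -/
theorem ChiefSeries.sum_classIndicator_sub (X : ChiefSeries K L)
    {A B : LieIdeal K L} (hn : IsNonabelian A B) :
    (X.sum (complementedIndicator (factorClass A B)) ≤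
      X.sum (classIndicator (factorClass A B))) ∧
    X.sum (classIndicator (factorClass A B)) ≤
      X.sum (complementedIndicator (factorClass A B)) + 1 := by
  classical
  have key : ∀ i : Fin X.length,
      classIndicator (factorClass A B) (X.ideal i.succ) (X.ideal i.castSucc) =
      complementedIndicator (factorClass A B) (X.ideal i.succ) (X.ideal i.castSucc) +
        if factorClass (X.ideal i.succ) (X.ideal i.castSucc) = factorClass A B ∧
          ¬ IsC (X.ideal i.succ) (X.ideal i.castSucc) then 1 else 0 := by
    intro i
    unfold classIndicator complementedIndicator
    split_ifs <;> simp_all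
  unfold ChiefSeries.sum
  rw [Finset.sum_congr rfl fun i _ => key i, Finset.sum_add_distrib, Finset.sum_boole]
  refine ⟨by simp, ?_⟩
  gcongr
  rw [← Nat.cast_one, Nat.cast_le, Finset.card_le_one]
  intro i hi j hj
  obtain ⟨-, hi, hi'⟩ := Finset.mem_filter.1 hi
  obtain ⟨-, hj, hj'⟩ := Finset.mem_filter.1 hj
  have hni := isNonabelian_of_equivalent hn (factorClass_eq_iff.1 hi.symm)
  have hnj := isNonabelian_of_equivalent hn (factorClass_eq_iff.1 hj.symm)
  exact le_antisymm (X.le_of_not_isC hnj (hj.trans hi.symm) hj')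
    (X.le_of_not_isC hni (hi.trans hj.symm) hi')

theorem ChiefSeries.numComplemented_eq_sum (X : ChiefSeries K L)
    (T : Finset (Quotient (lAlgSetoid K L)))
    (hT : ∀ i : Fin X.length, factorClass (X.ideal i.succ) (X.ideal i.castSucc) ∈ T) :
    (X.numComplemented : ℤ) =
      ∑ q ∈ T, X.sum (complementedIndicator q) := by
  classical
  unfold ChiefSeries.sum
  rw [Finset.sum_comm]
  have : ∀ i : Fin X.length,
      ∑ q ∈ T, complementedIndicator q (X.ideal i.succ) (X.ideal i.castSucc) =
        if IsC (X.ideal i.succ) (X.ideal i.castSucc) then 1 else 0 := by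
    intro i
    unfold complementedIndicator
    rw [Finset.sum_eq_single_of_mem _ (hT i) fun q _ hq =>
      if_neg fun (h : _ ∧ _) => hq h.1.symm]
    simp
  rw [Finset.sum_congr rfl fun i _ => this i, Finset.sum_boole, ChiefSeries.numComplemented,
    ← Set.ncard_coe_finset]
  simp

/-- A $cc'$-class occurs in some chief series, and multiplicities do not depend on the series, so it
occurs in a fixed series `Z`, which has finitely many factors. -/
theorem finite_ccClasses [FiniteDimensional K L] : (ccClasses K L).Finite := by
  classical
  obtain ⟨Z⟩ := exists_chiefSeries (K := K) (L := L)
  refine (Set.finite_range fun i =>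
    factorClass (Z.ideal (Fin.succ i)) (Z.ideal i.castSucc)).subset ?_
  rintro q ⟨A, ⟨-, X, Y, π, -, i, hA, -⟩, rfl⟩
  have hq : factorClass (X.ideal i.succ) (X.ideal i.castSucc) = Quotient.mk (lAlgSetoid K L) A :=
    (Quotient.sound (s := lAlgSetoid K L) hA).symm
  by_contra hZ
  have hsum := X.sum_classIndicator Z (Quotient.mk (lAlgSetoid K L) A)
  unfold ChiefSeries.sum at hsum
  have h0 : ∑ j : Fin Z.length, classIndicator (Quotient.mk (lAlgSetoid K L) A)
      (Z.ideal j.succ) (Z.ideal j.castSucc) = 0 :=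
    Finset.sum_eq_zero fun j _ => if_neg fun h => hZ ⟨j, h⟩
  rw [h0] at hsum
  have hpos := (Finset.sum_eq_zero_iff_of_nonneg fun j _ => by
    unfold classIndicator
    split_ifs <;> simp).1 hsum i (Finset.mem_univ i)
  unfold classIndicator at hpos
  rw [if_pos hq] at hpos
  exact one_ne_zero hpos

end ChiefFactors

open ChiefFactors in
theorem propositionl {K : Type*} [Field K] {L : Type*} [LieRing L] [LieAlgebra K L]
    [FiniteDimensional K L] :
    (ChiefFactors.ccClasses K L).Finite ∧
      ∀ X Y : ChiefFactors.ChiefSeries K L,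
        |(X.numComplemented : ℤ) - (Y.numComplemented : ℤ)| ≤
          ((ChiefFactors.ccClasses K L).ncard : ℤ) := by
  classical
  refine ⟨finite_ccClasses, fun X Y => ?_⟩
  let T : Finset (Quotient (lAlgSetoid K L)) :=
    Finset.univ.image (fun i => factorClass (X.ideal (Fin.succ i)) (X.ideal i.castSucc)) ∪
      Finset.univ.image (fun i => factorClass (Y.ideal (Fin.succ i)) (Y.ideal i.castSucc))
  rw [X.numComplemented_eq_sum T fun i =>
      Finset.mem_union_left _ (Finset.mem_image_of_mem _ (Finset.mem_univ i)),
    Y.numComplemented_eq_sum T fun i =>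
      Finset.mem_union_right _ (Finset.mem_image_of_mem _ (Finset.mem_univ i)),
    ← Finset.sum_sub_distrib]
  refine (Finset.abs_sum_le_sum_abs _ _).trans ?_
  -- Each class contributes at most 1, and contributes 0 unless it is of $cc'$-type: when the two
  -- counts differ, the class is nonabelian, and both counts lie in $\{n-1,n\}$ for the common class
  -- size $n$.
  refine (Finset.sum_le_sum (g := fun q => if q ∈ ccClasses K L then (1 : ℤ) else 0)
    fun q _ => ?_).trans ?_
  · by_cases h : X.sum (complementedIndicator q) =
        Y.sum (complementedIndicator q)
    · rw [h, sub_self, abs_zero]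
      split_ifs <;> simp
    · obtain ⟨hq, A, B, hn, rfl⟩ := mem_ccClasses_of_sum_ne h
      rw [if_pos hq, abs_le]
      have hX := X.sum_classIndicator_sub hn
      have hY := Y.sum_classIndicator_sub hn
      have := X.sum_classIndicator Y (factorClass A B)
      constructor <;> linarith [hX.1, hX.2, hY.1, hY.2]
  · rw [Finset.sum_boole, Nat.cast_le, ← Set.ncard_coe_finset]
    exact Set.ncard_le_ncard (fun q hq => (Finset.mem_filter.1 hq).2) finite_ccClasses
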